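/- Let $n\ge 2$ and $r>0$. Let $d\gamma_n(x)=(2\pi)^{-n/2}e^{-\|x\|^2/2}\,dx$ and, for measurable $A\subset\mathbb{R}^n$, let $F(A)=\sum_{i=1}^n\big(\int_A(1-x_i^2)\,d\gamma_n(x)\big)^2$. Let $A=B(0,r)$ (the open ball) or $A=B(0,r)^c$, and let $N$ be the exterior unit normal of $A$ on $\partial A=\partial B(0,r)$. A variation of $A$ is a family $A^{(t)}=\Psi(A,t)$, $-1<t<1$, where $X:\mathbb{R}^n\to\mathbb{R}^n$ is a $C^\infty$ vector field with a flow $\Psi:\mathbb{R}^n\times(-1,1)\to\mathbb{R}^n$, i.e. $\Psi(x,0)=x$ and $\frac{d}{dt}\Psi(x,t)=X(\Psi(x,t))$ for all $x\in\mathbb{R}^n$, $t\in(-1,1)$. It is called admissible if $\frac{d}{dt}\big|_{t=0}\gamma_n(A^{(t)})=0$ and $\frac{d^2}{dt^2}\big|_{t=0}\gamma_n(A^{(t)})=0$. Put $f=\langle X,N\rangle$ on $\partial B(0,r)$, $q_k(x)=(n-1)x_k^2-\sum_{j\ne k}x_j^2$ for $1\le k\le n$, and $$C_{n,r}=\frac{2r^{n+1}e^{-r^2}\,\mathrm{Vol}(S^{n-1})}{n(n+2)(2\pi)^n}>0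 ,$$ and let $dx$ in integrals over $\partial B(0,r)$ denote surface measure. (a) For every admissible variation, $t\mapsto F(A^{(t)})$ is twice differentiable at $0$, $\frac{d}{dt}\big|_{t=0}F(A^{(t)})=0$, and $$\frac12\frac{d^2}{dt^2}\Big|_{t=0}F(A^{(t)})\le C_{n,r}\,(r^2-n-2)\int_{\partial B(0,r)}f(x)^2\,dx ,$$ with equality if $f$ is a multiple of some $q_k$ on $\partial B(0,r)$. In particular, $\frac{d^2}{dt^2}\big|_{t=0}F(A^{(t)})\le 0$ if $r^2\le n+2$, and $\frac{d^2}{dt^2}\big|_{t=0}F(A^{(t)})<0$ if $r^2<n+2$ and $f$ is not identically zero on $\partial B(0,r)$. (b) For every $k\in\{1,\dots,n\}$ there is an admissible variation of $A$ with $A^{(t)}=-A^{(t)}$ for all $t\in(-1,1)$ whose vector field is given, in a neighborhood of $\partial B(0,r)$, by $X_k(x)=r(n-1)(x_k+g_k(x))$ and $X_j(x)=-r(x_j+g_j(x))$ for $j\neq k$, where $g_i(x)=(\|x\|^2-r^2)x_i/2$. It satisfies $\frac{d}{dt}\big|_{t=0}F(A^{(t)})=0$ and $\frac12\frac{d^2}{dt^2}\big|_{t=0}F(A^{(t)})=C_{n,r}\,(r^2-n-2)\int_{\partial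 B(0,r)}q_k(x)^2\,dx$. In particular, if $r^2>n+2$, then $\frac{d^2}{dt^2}\big|_{t=0}F(A^{(t)})>0$. -/

import Mathlib

open MeasureTheory Set Filter Topology

noncomputable section

/-- `n`-dimensional Euclidean space. -/
abbrev Eucl (n : ℕ) : Type := EuclideanSpace ℝ (Fin n)

/-- The standard Gaussian density `(2π)^(-n/2) exp(-‖x‖²/2)`. -/
def gaussDensity (n : ℕ) (x : Eucl n) : ℝ :=
  Real.exp (-(‖x‖ ^ 2 / 2)) / (2 * Real.pi) ^ ((n : ℝ) / 2)

/-- The standard Gaussian measure `γ_n` on `ℝⁿ`. -/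
def gaussMeasure (n : ℕ) : Measure (Eucl n) :=
  volume.withDensity (fun x => ENNReal.ofReal (gaussDensity n x))

/-- `F(A) = ∑ i, (∫_A (1 - x_i²) dγ_n)²`. -/
def fourierF {n : ℕ} (A : Set (Eucl n)) : ℝ :=
  ∑ i : Fin n, (∫ x in A, (1 - x i ^ 2) ∂(gaussMeasure n)) ^ 2

/-- `X` is a smooth vector field and `Ψ` is its flow on the time interval `(-1, 1)`;
the values `Ψ x t` for other times `t` play no role. -/
structure IsFlowOf {n : ℕ} (X : Eucl n → Eucl n) (Ψ : Eucl n → ℝ → Eucl n) : Prop where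
  smooth : ContDiff ℝ (⊤ : ℕ∞) X
  initial : ∀ x, Ψ x 0 = x
  ode : ∀ x, ∀ t ∈ Ioo (-1 : ℝ) 1, HasDerivAt (fun s => Ψ x s) (X (Ψ x t)) t

/-- The transported set `A^(t) = Ψ(A, t)`. -/
def flowSet {n : ℕ} (Ψ : Eucl n → ℝ → Eucl n) (A : Set (Eucl n)) (t : ℝ) : Set (Eucl n) :=
  (fun x => Ψ x t) '' A

/-- `φ` is differentiable near `t`, and its derivative has derivative `d` at `t`. -/
def HasSecondDerivAt (φ : ℝ → ℝ) (d t : ℝ) : Prop :=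
  (∀ᶠ s in 𝓝 t, DifferentiableAt ℝ φ s) ∧ HasDerivAt (deriv φ) d t

/-- The variation `t ↦ Ψ(A, t)` preserves Gaussian measure to first and second order at `t = 0`. -/
def PreservesGaussToSecondOrder {n : ℕ} (Ψ : Eucl n → ℝ → Eucl n) (A : Set (Eucl n)) : Prop :=
  HasDerivAt (fun t => (gaussMeasure n).real (flowSet Ψ A t)) 0 0 ∧
    HasSecondDerivAt (fun t => (gaussMeasure n).real (flowSet Ψ A t)) 0 0

/-- Either `A = B(0,r)` with exterior unit normal `N(x) = x/‖x‖` on `∂A`, or `A = B(0,r)ᶜ` with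
exterior unit normal `N(x) = -x/‖x‖` on `∂A`. (Only the values of `N` on the sphere `∂A` of
radius `r` matter.) -/
def IsBallOrComplWithNormal {n : ℕ} (r : ℝ) (A : Set (Eucl n)) (N : Eucl n → Eucl n) : Prop :=
  (A = Metric.ball 0 r ∧ N = fun x => ‖x‖⁻¹ • x) ∨
    (A = (Metric.ball 0 r)ᶜ ∧ N = fun x => -(‖x‖⁻¹ • x))

/-- `Vol(S^(n-1))`, the total surface measure of the unit sphere of `ℝⁿ`. -/
def sphereVol (n : ℕ) : ℝ :=
  ((volume : Measure (Eucl n)).toSphere).real univ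

/-- The integral of `f` over the sphere `∂B(0,r)` of `ℝⁿ` with respect to surface measure,
that is, `r^(n-1)` times the surface integral of `θ ↦ f (r θ)` over the unit sphere. -/
def sphereIntegral {n : ℕ} (r : ℝ) (f : Eucl n → ℝ) : ℝ :=
  r ^ (n - 1) * ∫ θ, f (r • (θ : Eucl n)) ∂((volume : Measure (Eucl n)).toSphere)

/-- The quadratic form `(n-1) x_k² - ∑_{j ≠ k} x_j²`. -/
def zonalForm {n : ℕ} (k : Fin n) (x : Eucl n) : ℝ :=
  ((n : ℝ) - 1) * x k ^ 2 - ∑ j ∈ Finset.univ.erase k, x j ^ 2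

/-- The vector field whose `k`-th component is `r (n-1) (x_k + g_k)` and whose `j`-th component is
`-r (x_j + g_j)` for `j ≠ k`, where `g_i = (‖x‖² - r²) x_i / 2`. -/
def explicitField {n : ℕ} (r : ℝ) (k : Fin n) (x : Eucl n) : Eucl n :=
  WithLp.toLp 2 fun j =>
    r * ((if j = k then (n : ℝ) - 1 else -1) * (x j + (‖x‖ ^ 2 - r ^ 2) * x j / 2))

/-- The number `2 r^(n+1) exp(-r²) Vol(S^(n-1)) / (n (n+2) (2π)^n) * (r² - n - 2)`. -/
def variationConst (n : ℕ) (r : ℝ) : ℝ :=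
  2 * r ^ (n + 1) * Real.exp (-r ^ 2) * sphereVol n /
    ((n : ℝ) * ((n : ℝ) + 2) * (2 * Real.pi) ^ n) * (r ^ 2 - n - 2)

end

/-! Write `I_i(t)` for the integral of `(1 - x_i²)γ` over the image of the ball at time `t`, where
`γ` is the Gaussian density. Over the whole space this integral vanishes, so passing to the
complement only changes the sign of `I_i`, and `F = ∑ I_i²` for the ball and its complement alike.

For smooth `g`, the derivative of the integral of `g` over the moving ball is the integral of `div
(g X)` over it. Applying this again with `div (g X)` in place of `g` and using the divergence
theorem on the ball expresses both derivatives at `0` as sphere integrals against `f = ⟨X, x⟩ / r`.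
The flow is not assumed smooth in the initial point. It suffices that `Ψ_s - id - s X` has Lipschitz
constant `O(s²)` on balls: then `Ψ_s` is injective there for small `s`, almost everywhere
differentiable, and has Jacobian `1 + s div X + o(s)`.

By symmetry all `I_i(0)` agree, so `F''/2 = ∑ I_i'² + I_1(0) ∑ I_i''`. The sum of the weights is `(n
- ‖x‖²)γ`. Its radial factor is constant on the sphere, so second-order preservation of measure
kills everything in `∑ I_i''` except `-2ργ-`type boundary mass, namely `-2ρr ∫ f²`, with `ρ` the
value of `γ` on the sphere. Also `I_i' = -ρ a_i` with `a_i = ∫ x_i² f`, and `∑ a_i = 0` because `f`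
has mean zero; hence `F' = 0`.

What remains is `∑ a_i² ≤ 2κ ∫ f²`, with `κ` the mixed fourth moment of the sphere
(`sum_sq_moment_le`). The moment matrix `∫ x_i² x_j² = κ(1 + 2δ_ij)` acts as `2κ` on vectors of sum
zero, so this is Bessel's inequality for `f` against the diagonal quadratic forms of trace zero.
Equality holds when `f` is such a form, in particular a multiple of `q_k`.

For (b), the explicit field has `f = q_k`, and its quadratic correction makes `div (γ X)` vanish on
the sphere, which gives the second-order condition. A cutoff provides a flow, and oddness of the
field provides symmetry. -/

noncomputable section

/-! ### Bounds on balls and uniqueness of integral curves -/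

theorem exists_lipschitzOnWith_closedBall {E F : Type*} [NormedAddCommGroup E] [NormedSpace ℝ E]
    [FiniteDimensional ℝ E] [NormedAddCommGroup F] [NormedSpace ℝ F] {f : E → F}
    (hf : ContDiff ℝ (⊤ : ℕ∞) f) (R : ℝ) :
    ∃ K : NNReal, LipschitzOnWith K f (Metric.closedBall 0 R) := by
  have := FiniteDimensional.proper_real E
  exact hf.contDiffOn.exists_lipschitzOnWith (by simp)
    (convex_closedBall 0 R) (isCompact_closedBall 0 R)

theorem exists_norm_le_closedBall {E F : Type*} [NormedAddCommGroup E] [NormedSpace ℝ E]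
    [FiniteDimensional ℝ E] [NormedAddCommGroup F] {f : E → F}
    (hf : Continuous f) (R : ℝ) :
    ∃ M : ℝ, 0 ≤ M ∧ ∀ x ∈ Metric.closedBall (0 : E) R, ‖f x‖ ≤ M := by
  have := FiniteDimensional.proper_real E
  obtain ⟨M, hM⟩ := (isCompact_closedBall (0 : E) R).exists_bound_of_continuousOn hf.continuousOn
  exact ⟨max M 0, le_max_right _ _, fun x hx => (hM x hx).trans (le_max_left _ _)⟩

/-- Two integral curves of a smooth field that meet coincide. -/
theorem integralCurve_eqOn_Ioo {E : Type*} [NormedAddCommGroup E] [NormedSpace ℝ E]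
    [FiniteDimensional ℝ E] {X : E → E} (hX : ContDiff ℝ (⊤ : ℕ∞) X) {α β : ℝ → E} {a b t₀ : ℝ}
    (ht₀ : t₀ ∈ Ioo a b) (hα : ∀ t ∈ Ioo a b, HasDerivAt α (X (α t)) t)
    (hβ : ∀ t ∈ Ioo a b, HasDerivAt β (X (β t)) t) (h : α t₀ = β t₀) :
    EqOn α β (Ioo a b) := by
  intro t ht
  -- On a compact interval around `t₀` and `t` both curves are bounded, so they lie in one ball,
  -- where the locally Lipschitz field has a single Lipschitz constant.
  obtain ⟨c, hac, hct⟩ := exists_between (lt_min ht₀.1 ht.1)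
  obtain ⟨d, htd, hdb⟩ := exists_between (max_lt ht₀.2 ht.2)
  obtain ⟨hc₀, hct⟩ := lt_min_iff.1 hct
  obtain ⟨hd₀, htd⟩ := max_lt_iff.1 htd
  have hsub : Icc c d ⊆ Ioo a b := fun s hs => ⟨hac.trans_le hs.1, hs.2.trans_lt hdb⟩
  obtain ⟨M, hM⟩ := isCompact_Icc.exists_bound_of_continuousOn
    (f := α) (s := Icc c d) fun s hs => (hα s (hsub hs)).continuousAt.continuousWithinAt
  obtain ⟨M', hM'⟩ := isCompact_Icc.exists_bound_of_continuousOn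
    (f := β) (s := Icc c d) fun s hs => (hβ s (hsub hs)).continuousAt.continuousWithinAt
  obtain ⟨K, hK⟩ := exists_lipschitzOnWith_closedBall hX (max M M')
  refine ODE_solution_unique_of_mem_Ioo (v := fun _ => X) (K := K)
    (s := fun _ => Metric.closedBall 0 (max M M')) (fun _ _ => hK) (a := c) (b := d) (t₀ := t₀)
    ⟨hc₀, hd₀⟩ (fun s hs => ⟨hα s (hsub (Ioo_subset_Icc_self hs)), ?_⟩)
    (fun s hs => ⟨hβ s (hsub (Ioo_subset_Icc_self hs)), ?_⟩) h ⟨hct, htd⟩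
  · simpa using Or.inl (hM s (Ioo_subset_Icc_self hs))
  · simpa using Or.inr (hM' s (Ioo_subset_Icc_self hs))

/-! ### Group law and Lipschitz remainder estimates for the flow -/

namespace IsFlowOf

variable {n : ℕ} {X : Eucl n → Eucl n} {Ψ : Eucl n → ℝ → Eucl n}

/-- Time reversal transfers estimates from nonnegative to negative times. -/
theorem neg (h : IsFlowOf X Ψ) : IsFlowOf (fun x => -X x) (fun x t => Ψ x (-t)) where
  smooth := h.smooth.neg
  initial x := by simpa using h.initial x
  ode x t ht := by
    have h1 := h.ode x (-t) ⟨by linarith [ht.2], by linarith [ht.1]⟩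
    simpa [Function.comp_def] using h1.scomp t (hasDerivAt_neg t)

/-- As functions of `s`, both sides are integral curves with the same value at `s = 0`, on the
interval where `s` and `t + s` both lie in `(-1, 1)`. -/
theorem apply_apply (h : IsFlowOf X Ψ) (x : Eucl n) {s t : ℝ} (ht : t ∈ Ioo (-1 : ℝ) 1)
    (hs : s ∈ Ioo (-1 : ℝ) 1) (hst : t + s ∈ Ioo (-1 : ℝ) 1) :
    Ψ (Ψ x t) s = Ψ x (t + s) := by
  refine integralCurve_eqOn_Ioo h.smooth (α := fun s => Ψ (Ψ x t) s) (β := fun s => Ψ x (t + s))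
    (a := max (-1) (-1 - t)) (b := min 1 (1 - t)) (t₀ := 0) ?_ ?_ ?_ ?_ ?_
  · simpa using ⟨ht.1, ht.2⟩
  · intro u hu
    exact h.ode _ u ⟨(le_max_left _ _).trans_lt hu.1, hu.2.trans_le (min_le_left _ _)⟩
  · intro u hu
    have h1 := (le_max_right _ _).trans_lt hu.1
    have h2 := hu.2.trans_le (min_le_right _ _)
    exact (h.ode x (t + u) ⟨by linarith, by linarith⟩).comp_const_add t u
  · simp [h.initial]
  · exact ⟨max_lt hs.1 (by linarith [hst.1]), lt_min hs.2 (by linarith [hst.2])⟩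

theorem apply_neg_apply (h : IsFlowOf X Ψ) (x : Eucl n) {t : ℝ} (ht : t ∈ Ioo (-1 : ℝ) 1) :
    Ψ (Ψ x t) (-t) = x := by
  rw [h.apply_apply x ht ⟨by linarith [ht.2], by linarith [ht.1]⟩ (by simp), add_neg_cancel,
    h.initial]

theorem bijective (h : IsFlowOf X Ψ) {t : ℝ} (ht : t ∈ Ioo (-1 : ℝ) 1) :
    Function.Bijective fun x => Ψ x t := by
  have ht' : -t ∈ Ioo (-1 : ℝ) 1 := ⟨by linarith [ht.2], by linarith [ht.1]⟩
  refine ⟨Function.LeftInverse.injective (g := fun x => Ψ x (-t)) fun x => h.apply_neg_apply x ht,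
    Function.RightInverse.surjective (g := fun x => Ψ x (-t)) fun x => ?_⟩
  simpa using h.apply_neg_apply x ht'

theorem flowSet_compl (h : IsFlowOf X Ψ) (A : Set (Eucl n)) {t : ℝ} (ht : t ∈ Ioo (-1 : ℝ) 1) :
    flowSet Ψ Aᶜ t = (flowSet Ψ A t)ᶜ :=
  image_compl_eq (h.bijective ht)

theorem flowSet_flowSet (h : IsFlowOf X Ψ) (A : Set (Eucl n)) {s t : ℝ}
    (ht : t ∈ Ioo (-1 : ℝ) 1) (hs : s ∈ Ioo (-1 : ℝ) 1) (hst : t + s ∈ Ioo (-1 : ℝ) 1) :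
    flowSet Ψ (flowSet Ψ A t) s = flowSet Ψ A (t + s) := by
  simp only [flowSet, image_image]
  exact image_congr fun x _ => h.apply_apply x ht hs hst

/-- Uniform estimates for the flow over a ball and small positive times. -/
theorem exists_forward_bounds (h : IsFlowOf X Ψ) (R : ℝ) :
    ∃ δ ∈ Ioo (0 : ℝ) 1, ∃ C : ℝ, 0 ≤ C ∧ ∀ s ∈ Icc 0 δ, ∀ x ∈ Metric.closedBall (0 : Eucl n) R,
      ‖Ψ x s‖ ≤ R + 1 ∧ ∀ y ∈ Metric.closedBall (0 : Eucl n) R,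
        ‖(Ψ x s - x - s • X x) - (Ψ y s - y - s • X y)‖ ≤ C * s ^ 2 * ‖x - y‖ := by
  obtain ⟨M, hM0, hM⟩ := exists_norm_le_closedBall h.smooth.continuous (R + 1)
  obtain ⟨K, hK⟩ := exists_lipschitzOnWith_closedBall h.smooth (R + 1)
  -- `Y` is the acceleration field: `X (Ψ x s)` has time derivative `Y (Ψ x s)`.
  set Y : Eucl n → Eucl n := fun x => fderiv ℝ X x (X x) with hY
  have hYs : ContDiff ℝ (⊤ : ℕ∞) Y :=
    (h.smooth.fderiv_right (by norm_cast)).clm_apply h.smooth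
  obtain ⟨J, hJ⟩ := exists_lipschitzOnWith_closedBall hYs (R + 1)
  -- Speed at most `M + 1` for a time at most `1 / (M + 1)` keeps a curve within radius `R + 1`; the
  -- `2` also forces `δ < 1`. In the constant, `exp K` is the Grönwall factor and `J` the Lipschitz
  -- constant of `Y`.
  refine ⟨1 / (M + 2), ⟨by positivity, ?_⟩, J * Real.exp K, by positivity, ?_⟩
  · rw [div_lt_one (by positivity)]; linarith
  set δ := 1 / (M + 2) with hδ
  have hδ0 : 0 < δ := by positivity
  have hδ1 : δ < 1 := by rw [hδ, div_lt_one (by positivity)]; linarith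
  have hmem : ∀ s ∈ Icc 0 δ, s ∈ Ioo (-1 : ℝ) 1 := fun s hs =>
    ⟨by linarith [hs.1], by linarith [hs.2]⟩
  have hder : ∀ x, ∀ s ∈ Icc 0 δ, HasDerivAt (fun s => Ψ x s) (X (Ψ x s)) s :=
    fun x s hs => h.ode x s (hmem s hs)
  have hMδ : (M + 1) * δ ≤ 1 := by
    rw [hδ, mul_one_div, div_le_one (by positivity)]; linarith
  have hbd : ∀ x ∈ Metric.closedBall (0 : Eucl n) R, ∀ s ∈ Icc 0 δ, ‖Ψ x s‖ ≤ R + 1 := by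
    intro x hx s hs
    have hB : ∀ s ∈ Icc 0 δ, R + (M + 1) * s ≤ R + 1 := fun s hs => by
      have : (M + 1) * s ≤ (M + 1) * δ := by gcongr; exact hs.2
      linarith
    -- The barrier has slope `M + 1` rather than `M` because the comparison needs a strict
    -- inequality at contact.
    refine (image_norm_le_of_norm_deriv_right_lt_deriv_boundary (f := fun s => Ψ x s)
      (f' := fun s => X (Ψ x s)) (B := fun s => R + (M + 1) * s) (B' := fun _ => M + 1)
      (fun s hs => (hder x s hs).continuousAt.continuousWithinAt)
      (fun s hs => (hder x s (Ico_subset_Icc_self hs)).hasDerivWithinAt) ?_ ?_ ?_ hs).trans (hB s hs)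
    · simpa [h.initial] using hx
    · intro s
      simpa using ((hasDerivAt_id s).const_mul (M + 1)).const_add R
    · intro s hs he
      refine (hM _ ?_).trans_lt (lt_add_one M)
      rw [mem_closedBall_zero_iff, he]
      exact hB s (Ico_subset_Icc_self hs)
  intro s hs x hx
  refine ⟨hbd x hx s hs, fun y hy => ?_⟩
  have hlip : ∀ u ∈ Icc 0 δ, ‖Ψ x u - Ψ y u‖ ≤ ‖x - y‖ * Real.exp K := by
    intro u hu
    have := dist_le_of_trajectories_ODE_of_mem (v := fun _ => X) (K := K)
      (s := fun _ => Metric.closedBall 0 (R + 1)) (f := fun s => Ψ x s) (g := fun s => Ψ y s)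
      (a := 0) (b := δ) (δ := ‖x - y‖) (fun _ _ => hK)
      (fun s hs => (hder x s hs).continuousAt.continuousWithinAt)
      (fun s hs => (hder x s (Ico_subset_Icc_self hs)).hasDerivWithinAt)
      (fun s hs => by simpa using hbd x hx s (Ico_subset_Icc_self hs))
      (fun s hs => (hder y s hs).continuousAt.continuousWithinAt)
      (fun s hs => (hder y s (Ico_subset_Icc_self hs)).hasDerivWithinAt)
      (fun s hs => by simpa using hbd y hy s (Ico_subset_Icc_self hs))
      (by simp [h.initial, dist_eq_norm]) u hu
    rw [dist_eq_norm] at this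
    refine this.trans ?_
    gcongr
    have : (K : ℝ) * (u - 0) ≤ K * 1 := by
      gcongr; linarith [hu.2]
    simpa using this
  have hXd : ∀ x, ∀ u ∈ Icc 0 δ, HasDerivAt (fun s => X (Ψ x s)) (Y (Ψ x u)) u := by
    intro x u hu
    exact ((h.smooth.differentiable (by simp)) (Ψ x u)).hasFDerivAt.comp_hasDerivAt u (hder x u hu)
  -- Differences of velocities drift at a rate controlled by the Lipschitz constant of `Y`. A
  -- further mean value estimate on `[0, s]` gives the factor `s²`.
  have hD : ∀ u ∈ Icc 0 δ, ‖(X (Ψ x u) - X (Ψ y u)) - (X x - X y)‖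
      ≤ J * Real.exp K * ‖x - y‖ * u := by
    intro u hu
    have := norm_image_sub_le_of_norm_deriv_le_segment' (f := fun u => X (Ψ x u) - X (Ψ y u))
      (f' := fun u => Y (Ψ x u) - Y (Ψ y u)) (a := 0) (b := δ) (C := J * Real.exp K * ‖x - y‖)
      (fun u hu => ((hXd x u hu).sub (hXd y u hu)).hasDerivWithinAt) (fun u hu => ?_) u hu
    · simpa [h.initial] using this
    · have hu := Ico_subset_Icc_self hu
      have h1 := hJ.dist_le_mul (Ψ x u) (by simpa using hbd x hx u hu) (Ψ y u)
        (by simpa using hbd y hy u hu)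
      rw [dist_eq_norm, dist_eq_norm] at h1
      refine h1.trans ?_
      rw [mul_assoc, mul_comm (Real.exp _)]
      gcongr
      exact hlip u hu
  have hfin := norm_image_sub_le_of_norm_deriv_le_segment'
    (f := fun u => (Ψ x u - Ψ y u) - u • (X x - X y))
    (f' := fun u => (X (Ψ x u) - X (Ψ y u)) - (X x - X y)) (a := 0) (b := s)
    (C := J * Real.exp K * ‖x - y‖ * s)
    (fun u hu => ?_) (fun u hu => ?_) s ⟨hs.1, le_rfl⟩
  · convert hfin using 1
    · simp only [h.initial, smul_sub, zero_smul, sub_zero]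
      congr 1; abel
    · ring
  · have hu' : u ∈ Icc 0 δ := ⟨hu.1, hu.2.trans hs.2⟩
    have := ((hder x u hu').fun_sub (hder y u hu')).fun_sub ((hasDerivAt_id u).smul_const (X x - X y))
    simpa using this.hasDerivWithinAt
  · refine (hD u ⟨hu.1, hu.2.le.trans hs.2⟩).trans ?_
    gcongr
    exact hu.2.le

/-- Uniform estimates for the flow over a ball and small times. -/
theorem exists_bounds (h : IsFlowOf X Ψ) (R : ℝ) :
    ∃ δ ∈ Ioo (0 : ℝ) 1, ∃ C : ℝ, 0 ≤ C ∧ ∀ s ∈ Icc (-δ) δ,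
      ∀ x ∈ Metric.closedBall (0 : Eucl n) R,
      ‖Ψ x s‖ ≤ R + 1 ∧ ∀ y ∈ Metric.closedBall (0 : Eucl n) R,
        ‖(Ψ x s - x - s • X x) - (Ψ y s - y - s • X y)‖ ≤ C * s ^ 2 * ‖x - y‖ := by
  obtain ⟨δ, hδ, C, hC, H⟩ := h.exists_forward_bounds R
  obtain ⟨δ', hδ', C', hC', H'⟩ := h.neg.exists_forward_bounds R
  refine ⟨min δ δ', ⟨lt_min hδ.1 hδ'.1, (min_le_left _ _).trans_lt hδ.2⟩, max C C',
    hC.trans (le_max_left _ _), fun s hs x hx => ?_⟩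
  rcases le_total 0 s with h0 | h0
  · obtain ⟨h1, h2⟩ := H s ⟨h0, hs.2.trans (min_le_left _ _)⟩ x hx
    refine ⟨h1, fun y hy => (h2 y hy).trans ?_⟩
    gcongr
    exact le_max_left _ _
  · obtain ⟨h1, h2⟩ := H' (-s) ⟨by linarith, by linarith [hs.1, min_le_right δ δ']⟩ x hx
    simp only [neg_neg, smul_neg, neg_smul, even_two.neg_pow] at h1 h2
    refine ⟨h1, fun y hy => (h2 y hy).trans ?_⟩
    gcongr
    exact le_max_right _ _

end IsFlowOf

/-! ### Divergence and first-order expansions -/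

/-- The divergence of a vector field on `ℝⁿ`. -/
def divergence {n : ℕ} (G : Eucl n → Eucl n) (x : Eucl n) : ℝ :=
  ∑ i, fderiv ℝ G x (EuclideanSpace.single i 1) i

section Divergence

variable {n : ℕ}

theorem sum_smul_single (x : Eucl n) : ∑ i, x i • EuclideanSpace.single i (1 : ℝ) = x := by
  ext j
  simp [Finset.sum_apply, Pi.single_apply]

theorem divergence_smul {g : Eucl n → ℝ} {G : Eucl n → Eucl n} {x : Eucl n}
    (hg : DifferentiableAt ℝ g x) (hG : DifferentiableAt ℝ G x) :
    divergence (fun y => g y • G y) x = fderiv ℝ g x (G x) + g x * divergence G x := by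
  have h1 : fderiv ℝ g x (G x) = ∑ i, G x i * fderiv ℝ g x (EuclideanSpace.single i 1) := by
    conv_lhs => rw [← sum_smul_single (G x)]
    simp
  rw [h1]
  simp only [divergence, fderiv_fun_smul hg hG, Finset.mul_sum, ← Finset.sum_add_distrib]
  refine Finset.sum_congr rfl fun i _ => ?_
  simp
  ring

theorem contDiff_divergence {G : Eucl n → Eucl n} (hG : ContDiff ℝ (⊤ : ℕ∞) G) :
    ContDiff ℝ (⊤ : ℕ∞) (divergence G) := by
  refine ContDiff.sum fun i _ => ?_
  have h1 : ContDiff ℝ (⊤ : ℕ∞) fun x => fderiv ℝ G x (EuclideanSpace.single i 1) :=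
    (hG.fderiv_right (by norm_cast)).clm_apply contDiff_const
  exact (contDiff_euclidean.1 h1) i

end Divergence

section Determinant

variable {n : ℕ}

/-- To first order, `det (1 + B) = 1 + tr B`. -/
theorem exists_abs_det_id_add_sub_le {ε : ℝ} (hε : 0 < ε) :
    ∃ η > 0, ∀ B : Eucl n →L[ℝ] Eucl n, ‖B‖ ≤ η →
      |(ContinuousLinearMap.id ℝ (Eucl n) + B).det - 1 - ∑ i, B (EuclideanSpace.single i 1) i|
        ≤ ε * ‖B‖ := by
  let M : (Eucl n →L[ℝ] Eucl n) → Matrix (Fin n) (Fin n) ℝ :=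
    fun B => Matrix.of fun i j => B (EuclideanSpace.single j 1) i
  have hM : ∀ B : Eucl n →L[ℝ] Eucl n, LinearMap.toMatrix (EuclideanSpace.basisFun (Fin n) ℝ).toBasis
      (EuclideanSpace.basisFun (Fin n) ℝ).toBasis (B : Eucl n →ₗ[ℝ] Eucl n) = M B := by
    intro B
    ext i j
    simp [LinearMap.toMatrix_apply, M]
  have hdet : ∀ B : Eucl n →L[ℝ] Eucl n,
      (ContinuousLinearMap.id ℝ (Eucl n) + B).det = (1 + M B).det := by
    intro B
    have h1 : ((ContinuousLinearMap.id ℝ (Eucl n) + B : Eucl n →L[ℝ] Eucl n) :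
        Eucl n →ₗ[ℝ] Eucl n) = LinearMap.id + (B : Eucl n →ₗ[ℝ] Eucl n) := rfl
    rw [ContinuousLinearMap.det, h1,
      ← LinearMap.det_toMatrix (EuclideanSpace.basisFun (Fin n) ℝ).toBasis, map_add, hM,
      LinearMap.toMatrix_id]
  have hdiff : DifferentiableAt ℝ
      (fun B : Eucl n →L[ℝ] Eucl n => (1 + M B).det) 0 := by
    simp only [Matrix.det_apply, Matrix.add_apply, M, Matrix.of_apply]
    have hij : ∀ i j : Fin n, Differentiable ℝ
        fun B : Eucl n →L[ℝ] Eucl n => B (EuclideanSpace.single j 1) i := fun i j =>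
      ((EuclideanSpace.proj i : Eucl n →L[ℝ] ℝ).comp
        (ContinuousLinearMap.apply ℝ (Eucl n) (EuclideanSpace.single j (1 : ℝ)))).differentiable
    fun_prop
  have hD : ∀ B : Eucl n →L[ℝ] Eucl n,
      fderiv ℝ (fun B : Eucl n →L[ℝ] Eucl n => (1 + M B).det) 0 B = (M B).trace := by
    intro B
    have h1 : HasDerivAt (fun t : ℝ => (1 + M (t • B)).det)
        (fderiv ℝ (fun B : Eucl n →L[ℝ] Eucl n => (1 + M B).det) 0 B) 0 := by
      have h2 : HasDerivAt (fun t : ℝ => t • B) B 0 := by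
        simpa using (hasDerivAt_id (0 : ℝ)).smul_const B
      have h3 : HasFDerivAt (fun B : Eucl n →L[ℝ] Eucl n => (1 + M B).det)
          (fderiv ℝ (fun B : Eucl n →L[ℝ] Eucl n => (1 + M B).det) 0) ((0 : ℝ) • B) := by
        rw [show (0 : ℝ) • B = 0 from zero_smul ℝ B]
        exact hdiff.hasFDerivAt
      exact h3.comp_hasDerivAt (0 : ℝ) h2
    have h3 : HasDerivAt (fun t : ℝ => (1 + M (t • B)).det) (M B).trace 0 := by
      have h4 : ∀ t : ℝ, M (t • B) = t • M B := fun t => by ext i j; simp [M]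
      -- Dividing the polynomial `det (1 + t M)` by `t` twice leaves the quadratic remainder; the
      -- two coefficients dropped are `1` and the trace.
      set p := ((1 + (Polynomial.X : Polynomial ℝ) • (M B).map Polynomial.C).det).divX.divX
      have h6 : ∀ t : ℝ, (1 + M (t • B)).det = 1 + (M B).trace * t + p.eval t * t ^ 2 :=
        fun t => by rw [h4, Matrix.det_one_add_smul]
      simp only [h6]
      have h5 := (((hasDerivAt_id (0 : ℝ)).const_mul (M B).trace).const_add 1).fun_add
        ((p.hasDerivAt 0).fun_mul ((hasDerivAt_id (0 : ℝ)).fun_pow 2))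
      simpa using h5
    exact h1.unique h3
  have hlo := hdiff.hasFDerivAt.isLittleO.def hε
  obtain ⟨η, hη, H⟩ := Metric.eventually_nhds_iff_ball.1 hlo
  refine ⟨η / 2, by positivity, fun B hB => ?_⟩
  have := H B (by rw [mem_ball_zero_iff]; linarith)
  rw [hD] at this
  have hM0 : M 0 = 0 := by ext i j; simp [M]
  rw [hdet]
  simpa [hM0, Matrix.trace, M] using this

end Determinant

/-- Second-order Taylor bound along a curve, on a symmetric interval. -/
theorem abs_sub_sub_mul_le_of_second_deriv {u u' u'' : ℝ → ℝ} {δ M s : ℝ} (hM : 0 ≤ M)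
    (hu : ∀ t ∈ Icc (-δ) δ, HasDerivAt u (u' t) t)
    (hu' : ∀ t ∈ Icc (-δ) δ, HasDerivAt u' (u'' t) t)
    (hb : ∀ t ∈ Icc (-δ) δ, |u'' t| ≤ M) (hs : s ∈ Icc (-δ) δ) :
    |u s - u 0 - s * u' 0| ≤ M * s ^ 2 := by
  have hδ : 0 ≤ δ := by linarith [hs.1, hs.2]
  have h0 : (0 : ℝ) ∈ Icc (-δ) δ := ⟨by linarith, hδ⟩
  have hsub : Icc (-|s|) |s| ⊆ Icc (-δ) δ :=
    Icc_subset_Icc (neg_le_neg (abs_le.2 hs)) (abs_le.2 hs)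
  have h1 : ∀ t ∈ Icc (-δ) δ, ‖u' t - u' 0‖ ≤ M * ‖t - 0‖ := fun t ht =>
    (convex_Icc (-δ) δ).norm_image_sub_le_of_norm_hasDerivWithin_le
      (fun x hx => (hu' x hx).hasDerivWithinAt) hb h0 ht
  have h2 := (convex_Icc (-|s|) |s|).norm_image_sub_le_of_norm_hasDerivWithin_le
    (f := fun t => u t - t * u' 0) (f' := fun t => u' t - u' 0) (C := M * |s|)
    (fun x hx => by
      simpa using ((hu x (hsub hx)).fun_sub
        ((hasDerivAt_id x).mul_const (u' 0))).hasDerivWithinAt)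
    (fun x hx => (h1 x (hsub hx)).trans (by
      rw [sub_zero, Real.norm_eq_abs]
      exact mul_le_mul_of_nonneg_left (abs_le.2 hx) hM))
    (x := 0) (y := s) ⟨by simp, by simp⟩ ⟨neg_abs_le s, le_abs_self s⟩
  simp only [zero_mul, sub_zero, Real.norm_eq_abs] at h2
  calc |u s - u 0 - s * u' 0| = |u s - s * u' 0 - u 0| := by congr 1; ring
    _ ≤ M * |s| * |s| := h2
    _ = M * s ^ 2 := by rw [mul_assoc, ← sq, sq_abs]

/-- Expansion of a product of two first-order expansions. -/
theorem abs_mul_sub_sub_le {a b c s d g ε K : ℝ} (hK : 0 ≤ K) (ha : |a| ≤ K)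
    (hb : |b| ≤ K) (hc : |c| ≤ K) (hs : |s| ≤ 1) (hsε : |s| ≤ ε) (hε1 : ε ≤ 1)
    (hd : |d - 1 - s * a| ≤ ε * |s|) (hg : |g - b - s * c| ≤ ε * |s|) :
    |d * g - b - s * (c + b * a)| ≤ ε * |s| * (K ^ 2 + 3 * K + 2) := by
  have hs0 := abs_nonneg s
  have hε : 0 ≤ ε := hs0.trans hsε
  have e : d * g - b - s * (c + b * a) =
      s * (s * (a * c)) + (1 + s * a) * (g - b - s * c) + (d - 1 - s * a) * g := by ring
  have h1 : |s * (s * (a * c))| ≤ ε * |s| * K ^ 2 := by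
    rw [abs_mul, abs_mul, abs_mul]
    calc |s| * (|s| * (|a| * |c|)) ≤ |s| * (ε * (K * K)) := by gcongr
      _ = _ := by ring
  have h2 : |(1 + s * a) * (g - b - s * c)| ≤ (1 + K) * (ε * |s|) := by
    rw [abs_mul]
    gcongr
    calc |1 + s * a| ≤ |1| + |s| * |a| := by rw [← abs_mul]; exact abs_add_le _ _
      _ ≤ 1 + 1 * K := by rw [abs_one]; gcongr
      _ = 1 + K := by ring
  have h3 : |g| ≤ 2 * K + 1 := by
    have : |g| ≤ |g - b - s * c| + |b| + |s * c| := by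
      calc |g| = |(g - b - s * c) + b + s * c| := by congr 1; ring
        _ ≤ _ := (abs_add_le _ _).trans (by gcongr; exact abs_add_le _ _)
    have h4 : |s * c| ≤ 1 * K := by rw [abs_mul]; gcongr
    have h5 : ε * |s| ≤ 1 * 1 := by gcongr
    linarith
  have h4 : |(d - 1 - s * a) * g| ≤ ε * |s| * (2 * K + 1) := by
    rw [abs_mul]; gcongr
  rw [e]
  calc _ ≤ |s * (s * (a * c))| + |(1 + s * a) * (g - b - s * c)| + |(d - 1 - s * a) * g| :=
        (abs_add_le _ _).trans (by gcongr; exact abs_add_le _ _)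
    _ ≤ ε * |s| * K ^ 2 + (1 + K) * (ε * |s|) + ε * |s| * (2 * K + 1) := by gcongr
    _ = _ := by ring

theorem eventually_mem_Icc_zero {δ : ℝ} (hδ : 0 < δ) : ∀ᶠ s in 𝓝 (0 : ℝ), s ∈ Icc (-δ) δ :=
  Icc_mem_nhds (by linarith) hδ

theorem eventually_abs_le {c : ℝ} (hc : 0 < c) : ∀ᶠ s in 𝓝 (0 : ℝ), |s| ≤ c :=
  (eventually_mem_Icc_zero hc).mono fun _ hs => abs_le.2 hs

/-! ### Uniform expansions of the flow and its Jacobian -/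

namespace IsFlowOf

variable {n : ℕ} {X : Eucl n → Eucl n} {Ψ : Eucl n → ℝ → Eucl n}

theorem eventually_bounded (h : IsFlowOf X Ψ) (R : ℝ) :
    ∀ᶠ s in 𝓝 (0 : ℝ), ∀ x ∈ Metric.closedBall (0 : Eucl n) R, ‖Ψ x s‖ ≤ R + 1 := by
  obtain ⟨δ, hδ, C, -, H⟩ := h.exists_bounds R
  filter_upwards [eventually_mem_Icc_zero hδ.1] with s hs x hx using (H s hs x hx).1

theorem hasDerivAt_comp (h : IsFlowOf X Ψ) {F : Type*} [NormedAddCommGroup F] [NormedSpace ℝ F]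
    {g : Eucl n → F} (hg : ContDiff ℝ (⊤ : ℕ∞) g) (x : Eucl n) {t : ℝ}
    (ht : t ∈ Ioo (-1 : ℝ) 1) :
    HasDerivAt (fun s => g (Ψ x s)) (fderiv ℝ g (Ψ x t) (X (Ψ x t))) t :=
  ((hg.differentiable (by simp)) (Ψ x t)).hasFDerivAt.comp_hasDerivAt t (h.ode x t ht)

theorem contDiff_fderiv_apply (h : IsFlowOf X Ψ) {F : Type*} [NormedAddCommGroup F]
    [NormedSpace ℝ F] {g : Eucl n → F} (hg : ContDiff ℝ (⊤ : ℕ∞) g) :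
    ContDiff ℝ (⊤ : ℕ∞) fun x => fderiv ℝ g x (X x) :=
  (hg.fderiv_right (by norm_cast)).clm_apply h.smooth

/-- Differentiating `g` twice along `X` gives the second time derivative of `g ∘ Ψ`. It is bounded
on the ball of radius `R + 1`, so the error is `O(s²)`, uniformly in `x`. -/
theorem eventually_comp_expansion (h : IsFlowOf X Ψ) (R : ℝ) {g : Eucl n → ℝ}
    (hg : ContDiff ℝ (⊤ : ℕ∞) g) {ε : ℝ} (hε : 0 < ε) :
    ∀ᶠ s in 𝓝 (0 : ℝ), ∀ x ∈ Metric.closedBall (0 : Eucl n) R,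
      |g (Ψ x s) - g x - s * fderiv ℝ g x (X x)| ≤ ε * |s| := by
  obtain ⟨δ, hδ, C, -, H⟩ := h.exists_bounds R
  have hg1 := h.contDiff_fderiv_apply hg
  have hg2 := h.contDiff_fderiv_apply hg1
  obtain ⟨M, hM0, hM⟩ := exists_norm_le_closedBall hg2.continuous (R + 1)
  filter_upwards [eventually_mem_Icc_zero hδ.1, eventually_abs_le (c := ε / (M + 1)) (by positivity)]
    with s hs hsε x hx
  have hmem : ∀ t ∈ Icc (-δ) δ, t ∈ Ioo (-1 : ℝ) 1 := fun t ht =>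
    ⟨by linarith [ht.1, hδ.2], by linarith [ht.2, hδ.2]⟩
  have := abs_sub_sub_mul_le_of_second_deriv (u := fun t => g (Ψ x t)) hM0
    (fun t ht => h.hasDerivAt_comp hg x (hmem t ht))
    (fun t ht => h.hasDerivAt_comp hg1 x (hmem t ht))
    (fun t ht => hM _ (by simpa using (H t ht x hx).1)) hs
  simp only [h.initial] at this
  refine this.trans ?_
  rw [← sq_abs, sq, ← mul_assoc]
  gcongr
  calc M * |s| ≤ M * (ε / (M + 1)) := by gcongr
    _ ≤ (M + 1) * (ε / (M + 1)) := by gcongr; linarith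
    _ = ε := by field_simp

/-- `Ψ_s - id` is `s X` plus the remainder, so its Lipschitz constant is `O(|s|)`. -/
theorem eventually_approximatesLinearOn (h : IsFlowOf X Ψ) (R : ℝ) {c : NNReal} (hc : 0 < c) :
    ∀ᶠ s in 𝓝 (0 : ℝ), ApproximatesLinearOn (fun x => Ψ x s) (ContinuousLinearMap.id ℝ (Eucl n))
      (Metric.ball 0 R) c := by
  obtain ⟨δ, hδ, C, hC, H⟩ := h.exists_bounds R
  obtain ⟨K, hK⟩ := exists_lipschitzOnWith_closedBall h.smooth R
  filter_upwards [eventually_mem_Icc_zero hδ.1,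
    eventually_abs_le (c := c / (C + K + 1)) (by positivity)] with s hs hsc x hx y hy
  replace hx := Metric.ball_subset_closedBall hx
  replace hy := Metric.ball_subset_closedBall hy
  have h1 := (H s hs x hx).2 y hy
  have h2 := hK.dist_le_mul x hx y hy
  rw [dist_eq_norm, dist_eq_norm] at h2
  have hs1 : |s| ≤ 1 := (abs_le.2 hs).trans hδ.2.le
  have e : Ψ x s - Ψ y s - (ContinuousLinearMap.id ℝ (Eucl n)) (x - y) =
      ((Ψ x s - x - s • X x) - (Ψ y s - y - s • X y)) + s • (X x - X y) := by
    simp only [ContinuousLinearMap.id_apply, smul_sub]; abel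
  rw [e]
  calc _ ≤ C * s ^ 2 * ‖x - y‖ + |s| * (K * ‖x - y‖) := by
        refine (norm_add_le _ _).trans ?_
        rw [norm_smul, Real.norm_eq_abs]
        gcongr
    _ = (C * |s| + K) * |s| * ‖x - y‖ := by rw [← sq_abs]; ring
    _ ≤ (C * 1 + K + 1) * (c / (C + K + 1)) * ‖x - y‖ := by
        have h3 : C * |s| + K ≤ C * 1 + K + 1 := by
          linarith [mul_le_mul_of_nonneg_left hs1 hC]
        gcongr
    _ = c * ‖x - y‖ := by
        rw [mul_one, mul_div_cancel₀]; positivity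

/-- At a point of differentiability the Lipschitz bound on the remainder bounds its derivative by `C
s²`. Thus only `s · DX` contributes to the determinant at first order. -/
theorem eventually_det_expansion (h : IsFlowOf X Ψ) (R : ℝ) {ε : ℝ} (hε : 0 < ε) :
    ∀ᶠ s in 𝓝 (0 : ℝ), ∀ x ∈ Metric.ball (0 : Eucl n) R,
      DifferentiableAt ℝ (fun y => Ψ y s) x →
        |(fderiv ℝ (fun y => Ψ y s) x).det - 1 - s * divergence X x| ≤ ε * |s| := by
  obtain ⟨δ, hδ, C, hC, H⟩ := h.exists_bounds R
  obtain ⟨K, hK0, hK⟩ := exists_norm_le_closedBall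
    (h.smooth.continuous_fderiv (by simp)) R
  obtain ⟨η, hη, hdet⟩ := exists_abs_det_id_add_sub_le (n := n) (ε := ε / (2 * (C + K + 1)))
    (by positivity)
  filter_upwards [eventually_mem_Icc_zero hδ.1,
    eventually_abs_le (c := η / (C + K + 1)) (by positivity),
    eventually_abs_le (c := ε / (2 * (n * C + 1))) (by positivity)] with s hs hsη hsε x hx hdiff
  have hx' := Metric.ball_subset_closedBall hx
  have hs1 : |s| ≤ 1 := (abs_le.2 hs).trans hδ.2.le
  set D := fderiv ℝ (fun y => Ψ y s) x with hD
  have hXd : HasFDerivAt X (fderiv ℝ X x) x := (h.smooth.differentiable (by simp) x).hasFDerivAt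
  have hQ : HasFDerivAt (fun y => Ψ y s - y - s • X y)
      (D - ContinuousLinearMap.id ℝ (Eucl n) - s • fderiv ℝ X x) x :=
    (hdiff.hasFDerivAt.sub (hasFDerivAt_id x)).sub (hXd.const_smul s)
  have hQn : ‖D - ContinuousLinearMap.id ℝ (Eucl n) - s • fderiv ℝ X x‖ ≤ C * s ^ 2 := by
    have hnn : 0 ≤ C * s ^ 2 := by positivity
    refine hQ.le_of_lipschitzOn (C := ⟨C * s ^ 2, hnn⟩) (Metric.isOpen_ball.mem_nhds hx)
      (LipschitzOnWith.of_dist_le_mul fun y hy z hz => ?_)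
    rw [dist_eq_norm, dist_eq_norm]
    exact (H s hs y (Metric.ball_subset_closedBall hy)).2 z (Metric.ball_subset_closedBall hz)
  set Q := D - ContinuousLinearMap.id ℝ (Eucl n) - s • fderiv ℝ X x with hQdef
  set B := s • fderiv ℝ X x + Q with hB
  have hDB : D = ContinuousLinearMap.id ℝ (Eucl n) + B := by rw [hB, hQdef]; abel
  have hBn : ‖B‖ ≤ (C + K + 1) * |s| := by
    calc ‖B‖ ≤ |s| * K + C * s ^ 2 := by
          refine (norm_add_le _ _).trans (add_le_add ?_ hQn)
          rw [norm_smul, Real.norm_eq_abs]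
          gcongr
          exact hK x hx'
      _ = (C * |s| + K) * |s| := by rw [← sq_abs]; ring
      _ ≤ (C + K + 1) * |s| := by
          have h3 : C * |s| + K ≤ C + K + 1 := by
            linarith [mul_le_mul_of_nonneg_left hs1 hC]
          gcongr
  have hBη : ‖B‖ ≤ η := hBn.trans (by
    rw [← le_div_iff₀' (by positivity)]; exact hsη)
  have h1 := hdet B hBη
  have htr : ∑ i, B (EuclideanSpace.single i 1) i =
      s * divergence X x + ∑ i, Q (EuclideanSpace.single i 1) i := by
    rw [divergence, Finset.mul_sum, ← Finset.sum_add_distrib]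
    exact Finset.sum_congr rfl fun i _ => by simp [hB]
  have hQtr : |∑ i, Q (EuclideanSpace.single i 1) i| ≤ n * (C * s ^ 2) := by
    refine (Finset.abs_sum_le_sum_abs _ _).trans ?_
    refine (Finset.sum_le_card_nsmul _ _ (C * s ^ 2) fun i _ => ?_).trans (by simp)
    refine (PiLp.norm_apply_le (Q (EuclideanSpace.single i 1)) i).trans ?_
    refine (Q.le_opNorm _).trans ?_
    simpa using hQn
  rw [hDB]
  have h2 : ε / (2 * (C + K + 1)) * ‖B‖ ≤ ε / 2 * |s| := by
    calc _ ≤ ε / (2 * (C + K + 1)) * ((C + K + 1) * |s|) := by gcongr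
      _ = ε / 2 * |s| := by field_simp
  have h3 : n * (C * s ^ 2) ≤ ε / 2 * |s| := by
    rw [← sq_abs, sq, ← mul_assoc, ← mul_assoc]
    gcongr
    calc n * C * |s| ≤ (n * C + 1) * (ε / (2 * (n * C + 1))) := by
          gcongr; linarith
      _ = ε / 2 := by field_simp
  calc _ = |((ContinuousLinearMap.id ℝ (Eucl n) + B).det - 1
          - ∑ i, B (EuclideanSpace.single i 1) i) + ∑ i, Q (EuclideanSpace.single i 1) i| := by
        rw [htr]; congr 1; ring
    _ ≤ ε / 2 * |s| + ε / 2 * |s| := (abs_add_le _ _).trans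
        (add_le_add (h1.trans h2) (hQtr.trans h3))
    _ = ε * |s| := by ring

end IsFlowOf

theorem injOn_of_approximatesLinearOn_id {n : ℕ} {f : Eucl n → Eucl n} {s : Set (Eucl n)}
    {c : NNReal} (hf : ApproximatesLinearOn f (ContinuousLinearMap.id ℝ (Eucl n)) s c)
    (hc : c < 1) : InjOn f s := by
  intro x hx y hy hxy
  have h1 := hf x hx y hy
  simp only [hxy, sub_self, ContinuousLinearMap.id_apply, zero_sub, norm_neg] at h1
  by_contra hne
  have h2 : 0 < ‖x - y‖ := norm_pos_iff.2 (sub_ne_zero.2 hne)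
  have h3 : (c : ℝ) < 1 := by exact_mod_cast hc
  nlinarith

/-! ### Change of variables and the first variation of an integral -/

namespace IsFlowOf

variable {n : ℕ} {X : Eucl n → Eucl n} {Ψ : Eucl n → ℝ → Eucl n}

/-- For small times the flow is injective and almost everywhere differentiable on a ball,
maps null sets to null sets and measurable sets to measurable sets. -/
theorem eventually_regular (h : IsFlowOf X Ψ) (R : ℝ) :
    ∀ᶠ s in 𝓝 (0 : ℝ), InjOn (fun x => Ψ x s) (Metric.ball 0 R) ∧
      ContinuousOn (fun x => Ψ x s) (Metric.ball 0 R) ∧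
      (∀ᵐ x ∂(volume : Measure (Eucl n)).restrict (Metric.ball 0 R),
        DifferentiableAt ℝ (fun y => Ψ y s) x) ∧
      ∀ T ⊆ Metric.ball (0 : Eucl n) R, volume T = 0 → volume (flowSet Ψ T s) = 0 := by
  -- Any constant above `|det id| = 1` serves; only preservation of null sets is needed.
  have hdet : ENNReal.ofReal |(ContinuousLinearMap.id ℝ (Eucl n)).det| < (2 : NNReal) := by
    simp [ContinuousLinearMap.det]
  have hvol := addHaar_image_le_mul_of_det_lt (volume : Measure (Eucl n))
    (ContinuousLinearMap.id ℝ (Eucl n)) hdet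
  have hone : ∀ᶠ δ : NNReal in 𝓝[>] 0, δ < 1 :=
    nhdsWithin_le_nhds (Iio_mem_nhds one_pos)
  obtain ⟨c, ⟨hcvol, hc1⟩, hc0⟩ := ((hvol.and hone).and self_mem_nhdsWithin).exists
  filter_upwards [h.eventually_approximatesLinearOn R hc0] with s hs
  obtain ⟨K, hK⟩ : ∃ K : NNReal, LipschitzOnWith K (fun x => Ψ x s) (Metric.ball 0 R) := by
    refine ⟨c + 1, LipschitzOnWith.of_dist_le_mul fun x hx y hy => ?_⟩
    have h1 := hs x hx y hy
    rw [dist_eq_norm, dist_eq_norm]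
    simp only [ContinuousLinearMap.id_apply] at h1
    have h2 := norm_sub_norm_le (Ψ x s - Ψ y s) (x - y)
    push_cast
    linarith
  refine ⟨injOn_of_approximatesLinearOn_id hs hc1, hK.continuousOn, ?_, fun T hT h0 => ?_⟩
  · filter_upwards [hK.ae_differentiableWithinAt (μ := volume) measurableSet_ball,
      ae_restrict_mem measurableSet_ball] with x hx hxR
    exact hx.differentiableAt (Metric.isOpen_ball.mem_nhds hxR)
  · have := hcvol T _ (hs.mono_set hT)
    rw [h0, mul_zero] at this
    exact le_antisymm this zero_le

theorem eventually_measurableSet_flowSet (h : IsFlowOf X Ψ) (R : ℝ) :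
    ∀ᶠ s in 𝓝 (0 : ℝ), ∀ E ⊆ Metric.ball (0 : Eucl n) R, MeasurableSet E →
      MeasurableSet (flowSet Ψ E s) := by
  filter_upwards [h.eventually_regular R] with s hs E hE hm
  exact hm.image_of_continuousOn_injOn (hs.2.1.mono hE) (hs.1.mono hE)

/-- By Rademacher's theorem the points of nondifferentiability are null, and so is their image. The
change of variables formula on the remaining points therefore gives the full integral. -/
theorem eventually_setIntegral_flowSet (h : IsFlowOf X Ψ) (R : ℝ) {g : Eucl n → ℝ}
    (hg : Continuous g) :
    ∀ᶠ s in 𝓝 (0 : ℝ), ∀ E ⊆ Metric.ball (0 : Eucl n) R, MeasurableSet E →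
      IntegrableOn (fun x => |(fderiv ℝ (fun y => Ψ y s) x).det| * g (Ψ x s)) E ∧
      ∫ x in flowSet Ψ E s, g x =
        ∫ x in E, |(fderiv ℝ (fun y => Ψ y s) x).det| * g (Ψ x s) := by
  filter_upwards [h.eventually_regular R, h.eventually_bounded R]
    with s ⟨hinj, hcont, hae, hnull⟩ hbd E hE hm
  set D : Set (Eucl n) := {x | DifferentiableAt ℝ (fun y => Ψ y s) x} with hD
  have hDm : MeasurableSet D := measurableSet_of_differentiableAt ℝ _
  have hE' : E ∩ D ⊆ Metric.ball 0 R := inter_subset_left.trans hE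
  have hEm : MeasurableSet (E ∩ D) := hm.inter hDm
  have h0 : volume (E \ D) = 0 := by
    have h1 : ∀ᵐ x ∂(volume : Measure (Eucl n)), x ∈ Metric.ball (0 : Eucl n) R → x ∈ D :=
      (ae_restrict_iff' measurableSet_ball).1 hae
    refine measure_mono_null ?_ h1
    rintro x ⟨hx, hxD⟩ hx'
    exact hxD (hx' (hE hx))
  have hEae : (E ∩ D : Set (Eucl n)) =ᵐ[volume] E := by
    have := sdiff_null_ae_eq_self (s := E) h0
    rwa [sdiff_sdiff_right_self] at this
  have himg : (flowSet Ψ E s : Set (Eucl n)) =ᵐ[volume] flowSet Ψ (E ∩ D) s := by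
    have h1 : flowSet Ψ E s = flowSet Ψ (E ∩ D) s ∪ flowSet Ψ (E \ D) s := by
      rw [flowSet, flowSet, flowSet, ← image_union, inter_union_sdiff]
    rw [h1]
    exact union_ae_eq_left_of_ae_eq_empty
      (ae_eq_empty.2 (hnull _ (sdiff_subset.trans hE) h0))
  have hder : ∀ x ∈ E ∩ D, HasFDerivWithinAt (fun y => Ψ y s) (fderiv ℝ (fun y => Ψ y s) x)
      (E ∩ D) x := fun x hx => hx.2.hasFDerivAt.hasFDerivWithinAt
  have hcv := integral_image_eq_integral_abs_det_fderiv_smul volume hEm hder (hinj.mono hE') g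
  have hint := (integrableOn_image_iff_integrableOn_abs_det_fderiv_smul volume hEm hder
    (hinj.mono hE') g).1 (by
      refine (hg.continuousOn.integrableOn_compact
        (isCompact_closedBall (0 : Eucl n) (R + 1))).mono_set ?_
      rintro _ ⟨x, hx, rfl⟩
      simpa using hbd x (Metric.ball_subset_closedBall (hE' hx)))
  refine ⟨hint.congr_set_ae hEae.symm, ?_⟩
  rw [setIntegral_congr_set himg, ← setIntegral_congr_set hEae]
  exact hcv

/-- The first variation of `∫_E g` along a flow is the integral over `E` of `div (g X)`. -/
theorem hasDerivAt_setIntegral_flowSet_zero (h : IsFlowOf X Ψ) {R : ℝ} {E : Set (Eucl n)}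
    (hE : E ⊆ Metric.ball 0 R) (hm : MeasurableSet E) {g : Eucl n → ℝ}
    (hg : ContDiff ℝ (⊤ : ℕ∞) g) :
    HasDerivAt (fun s => ∫ x in flowSet Ψ E s, g x)
      (∫ x in E, divergence (fun y => g y • X y) x) 0 := by
  have hdiv : ∀ x, divergence (fun y => g y • X y) x =
      fderiv ℝ g x (X x) + g x * divergence X x := fun x =>
    divergence_smul (hg.differentiable (by simp) x) (h.smooth.differentiable (by simp) x)
  have hcdiv := (contDiff_divergence h.smooth).continuous
  have hcg1 := (h.contDiff_fderiv_apply hg).continuous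
  have hcL : Continuous (divergence fun y => g y • X y) :=
    (contDiff_divergence (hg.smul h.smooth)).continuous
  have hEfin : volume E < ⊤ := (measure_mono hE).trans_lt measure_ball_lt_top
  have hintc : ∀ {f : Eucl n → ℝ}, Continuous f → IntegrableOn f E := fun hf =>
    (hf.continuousOn.integrableOn_compact (isCompact_closedBall (0 : Eucl n) R)).mono_set
      (hE.trans Metric.ball_subset_closedBall)
  obtain ⟨K₁, hK₁0, hK₁⟩ := exists_norm_le_closedBall hcdiv R
  obtain ⟨K₂, -, hK₂⟩ := exists_norm_le_closedBall hg.continuous R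
  obtain ⟨K₃, -, hK₃⟩ := exists_norm_le_closedBall hcg1 R
  set K := max K₁ (max K₂ K₃) with hKdef
  have hK0 : 0 ≤ K := hK₁0.trans (le_max_left _ _)
  rw [hasDerivAt_iff_isLittleO, Asymptotics.isLittleO_iff]
  intro c hc
  set P := (K ^ 2 + 3 * K + 2) * (volume.real E + 1) with hP
  have hvol0 : 0 ≤ volume.real E := measureReal_nonneg
  have hP0 : 0 < P := by positivity
  -- The bound `c / P` turns the accumulated pointwise error into `c |s|`. The bound `1` keeps the
  -- product estimate applicable.
  set ε := min 1 (min (1 / 2 / (K + 1)) (c / P)) with hε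
  have hε0 : 0 < ε := by positivity
  filter_upwards [h.eventually_regular R, h.eventually_setIntegral_flowSet R hg.continuous,
    h.eventually_det_expansion R hε0, h.eventually_comp_expansion R hg hε0,
    eventually_abs_le (c := min (1 / 2 / (K + 1)) ε) (by positivity)]
    with s hreg hcv hdet hcomp hsmall
  have hs1 : |s| ≤ ε := hsmall.trans (min_le_right _ _)
  have hs2 : |s| ≤ 1 / 2 / (K + 1) := hsmall.trans (min_le_left _ _)
  have hε1 : ε ≤ 1 := min_le_left _ _
  obtain ⟨hint, hcv⟩ := hcv E hE hm
  have hinit : flowSet Ψ E 0 = E := by simp [flowSet, h.initial]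
  have hint' : IntegrableOn
      (fun x => |(fderiv ℝ (fun y => Ψ y s) x).det| * g (Ψ x s) - g x) E :=
    hint.sub (hintc hg.continuous)
  rw [hcv, hinit, sub_zero, smul_eq_mul, ← integral_const_mul, ← integral_sub hint
    (hintc hg.continuous), ← integral_sub hint' ((hintc hcL).const_mul s)]
  have hpt : ∀ᵐ x ∂volume.restrict E,
      ‖|(fderiv ℝ (fun y => Ψ y s) x).det| * g (Ψ x s) - g x
        - s * divergence (fun y => g y • X y) x‖ ≤ ε * |s| * (K ^ 2 + 3 * K + 2) := by
    filter_upwards [ae_restrict_of_ae_restrict_of_subset hE hreg.2.2.1, ae_restrict_mem hm]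
      with x hx hxE
    have hxb := hE hxE
    have hxc := Metric.ball_subset_closedBall hxb
    have ha : |divergence X x| ≤ K := (hK₁ x hxc).trans (le_max_left _ _)
    have hd := hdet x hxb hx
    have hsK : |s| * (K + 1) ≤ 1 / 2 := (le_div_iff₀ (by positivity)).1 hs2
    -- The Jacobian is at least `1 - |s| (K + 1) ≥ 1 / 2`, so its absolute value can be dropped.
    have hpos : 0 ≤ (fderiv ℝ (fun y => Ψ y s) x).det := by
      have h1 := (abs_le.1 hd).1
      have h2 : |s * divergence X x| ≤ |s| * K := by rw [abs_mul]; gcongr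
      have h3 := (abs_le.1 h2).1
      have h4 : ε * |s| ≤ 1 * |s| := by gcongr
      nlinarith
    rw [abs_of_nonneg hpos, hdiv, Real.norm_eq_abs]
    refine abs_mul_sub_sub_le hK0 ha ?_ ?_ (hs1.trans hε1) hs1 hε1 hd (hcomp x hxc)
    · exact (hK₂ x hxc).trans ((le_max_left _ _).trans (le_max_right _ _))
    · exact (hK₃ x hxc).trans ((le_max_right _ _).trans (le_max_right _ _))
  refine (norm_setIntegral_le_of_norm_le_const_ae hEfin hpt).trans ?_
  have hεc : ε ≤ c / P := (min_le_right _ _).trans (min_le_right _ _)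
  calc ε * |s| * (K ^ 2 + 3 * K + 2) * volume.real E
      ≤ ε * |s| * (K ^ 2 + 3 * K + 2) * (volume.real E + 1) := by gcongr; linarith
    _ = ε * P * |s| := by rw [hP]; ring
    _ ≤ c / P * P * |s| := by gcongr
    _ = c * ‖s‖ := by rw [div_mul_cancel₀ _ hP0.ne', Real.norm_eq_abs]

/-- The derivative of `t ↦ ∫_{Ψ(B,t)} g` is `t ↦ ∫_{Ψ(B,t)} div (g X)`, for times near `0`. -/
theorem eventually_hasDerivAt_setIntegral_flowSet (h : IsFlowOf X Ψ) (r : ℝ) {g : Eucl n → ℝ}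
    (hg : ContDiff ℝ (⊤ : ℕ∞) g) :
    ∀ᶠ t in 𝓝 (0 : ℝ), HasDerivAt (fun s => ∫ x in flowSet Ψ (Metric.ball 0 r) s, g x)
      (∫ x in flowSet Ψ (Metric.ball 0 r) t, divergence (fun y => g y • X y) x) t := by
  filter_upwards [h.eventually_bounded r, h.eventually_measurableSet_flowSet r,
    Ioo_mem_nhds (show (-1 : ℝ) < 0 by norm_num) one_pos] with t hbd hmeas ht
  have hsub : flowSet Ψ (Metric.ball 0 r) t ⊆ Metric.ball 0 (r + 2) := by
    rintro _ ⟨x, hx, rfl⟩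
    have := hbd x (Metric.ball_subset_closedBall hx)
    rw [mem_ball_zero_iff]; linarith
  -- The moved ball at time `t` is a bounded measurable set. The formula at time zero applies to it,
  -- and the group law translates the result to time `t`.
  have h1 := h.hasDerivAt_setIntegral_flowSet_zero hsub
    (hmeas _ Subset.rfl measurableSet_ball) hg
  rw [show (0 : ℝ) = t - t by ring] at h1
  have h2 := h1.comp_sub_const t t
  refine h2.congr_of_eventuallyEq ?_
  have hnear : ∀ᶠ s in 𝓝 t, s - t ∈ Ioo (-1 : ℝ) 1 := by
    have : Tendsto (fun s => s - t) (𝓝 t) (𝓝 0) := by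
      simpa using (continuous_id.sub continuous_const).tendsto (x := t) (f := fun s => s - t)
    exact this (Ioo_mem_nhds (by norm_num) one_pos)
  filter_upwards [hnear, Ioo_mem_nhds ht.1 ht.2] with s hs hs'
  rw [h.flowSet_flowSet _ ht hs (by simpa using hs'), add_sub_cancel]

end IsFlowOf

/-! ### Sphere integrals and polar coordinates -/

section SphereIntegral

variable {n : ℕ}

theorem sphereIntegral_congr {r : ℝ} (hr : 0 ≤ r) {f g : Eucl n → ℝ}
    (h : ∀ x, ‖x‖ = r → f x = g x) : sphereIntegral r f = sphereIntegral r g := by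
  unfold sphereIntegral
  congr 2
  ext θ
  refine h _ ?_
  rw [norm_smul, Real.norm_of_nonneg hr, norm_eq_of_mem_sphere θ, mul_one]

theorem continuous_sphereIntegral {f : Eucl n → ℝ} (hf : Continuous f) :
    Continuous fun s : ℝ => sphereIntegral s f := by
  unfold sphereIntegral
  refine (continuous_pow _).mul ?_
  have h1 : Continuous (Function.uncurry
      fun (s : ℝ) (θ : Metric.sphere (0 : Eucl n) 1) => f (s • (θ : Eucl n))) := by
    refine hf.comp ?_
    exact continuous_fst.smul (continuous_subtype_val.comp continuous_snd)
  have := continuous_parametric_integral_of_continuous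
    (μ := (volume : Measure (Eucl n)).toSphere) h1 isCompact_univ
  simpa using this

theorem integrable_comp_smul_toSphere {f : Eucl n → ℝ} (r : ℝ) (hf : Continuous f) :
    Integrable (fun θ : Metric.sphere (0 : Eucl n) 1 => f (r • (θ : Eucl n)))
      (volume : Measure (Eucl n)).toSphere := by
  have hc : Continuous fun θ : Metric.sphere (0 : Eucl n) 1 => f (r • (θ : Eucl n)) :=
    hf.comp (continuous_subtype_val.const_smul r)
  exact hc.integrable_of_hasCompactSupport (HasCompactSupport.of_compactSpace _)

theorem sphereIntegral_add {f g : Eucl n → ℝ} (r : ℝ) (hf : Continuous f) (hg : Continuous g) :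
    sphereIntegral r (fun x => f x + g x) = sphereIntegral r f + sphereIntegral r g := by
  unfold sphereIntegral
  rw [integral_add (integrable_comp_smul_toSphere r hf) (integrable_comp_smul_toSphere r hg),
    mul_add]

theorem sphereIntegral_const_mul (r c : ℝ) (f : Eucl n → ℝ) :
    sphereIntegral r (fun x => c * f x) = c * sphereIntegral r f := by
  unfold sphereIntegral
  rw [integral_const_mul]
  ring

theorem sphereIntegral_sum {ι : Type*} (s : Finset ι) {f : ι → Eucl n → ℝ} (r : ℝ)
    (hf : ∀ i ∈ s, Continuous (f i)) :
    sphereIntegral r (fun x => ∑ i ∈ s, f i x) = ∑ i ∈ s, sphereIntegral r (f i) := by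
  unfold sphereIntegral
  rw [integral_finsetSum s fun i hi => integrable_comp_smul_toSphere r (hf i hi),
    Finset.mul_sum]

/-- Integration in polar coordinates. -/
theorem integral_eq_integral_sphereIntegral (hn : 0 < n) {f : Eucl n → ℝ} (hf : Integrable f) :
    ∫ x, f x = ∫ s in Ioi (0 : ℝ), sphereIntegral s f := by
  have : NeZero n := ⟨hn.ne'⟩
  have : Nontrivial (Eucl n) := inferInstance
  set μ : Measure (Eucl n) := volume
  have hmp := μ.measurePreserving_homeomorphUnitSphereProd
  have hemb := (homeomorphUnitSphereProd (Eucl n)).measurableEmbedding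
  set F : Metric.sphere (0 : Eucl n) 1 × Ioi (0 : ℝ) → ℝ := fun p => f ((p.2 : ℝ) • (p.1 : Eucl n))
  have hF : ∀ x : ({(0 : Eucl n)}ᶜ : Set (Eucl n)), F (homeomorphUnitSphereProd (Eucl n) x) =
      f x := by
    intro x
    have := homeomorphUnitSphereProd_symm_apply_coe (Eucl n) (homeomorphUnitSphereProd (Eucl n) x)
    rw [Homeomorph.symm_apply_apply] at this
    simp only [F, ← this]
  have hFint : Integrable F (μ.toSphere.prod (.volumeIoiPow (Module.finrank ℝ (Eucl n) - 1))) := by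
    rw [← hmp.integrable_comp_emb hemb]
    simp only [Function.comp_def, hF]
    rw [← Function.comp_def f, ← integrableOn_iff_comap_subtypeVal (measurableSet_singleton _).compl]
    exact hf.integrableOn
  have h1 : ∫ x, f x ∂μ =
      ∫ p, F p ∂(μ.toSphere.prod (.volumeIoiPow (Module.finrank ℝ (Eucl n) - 1))) := by
    rw [← hmp.integral_comp hemb]
    simp only [hF]
    rw [integral_subtype_comap (measurableSet_singleton _).compl f, restrict_compl_singleton]
  rw [h1, integral_prod_symm _ hFint]
  simp only [Measure.volumeIoiPow, ENNReal.ofReal, F, finrank_euclideanSpace, Fintype.card_fin]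
  rw [integral_withDensity_eq_integral_smul,
    integral_subtype_comap measurableSet_Ioi fun a : ℝ => Real.toNNReal (a ^ (n - 1)) •
      ∫ θ, f (a • (θ : Eucl n)) ∂μ.toSphere]
  · refine setIntegral_congr_fun measurableSet_Ioi fun x hx => ?_
    simp only [sphereIntegral, NNReal.smul_def, smul_eq_mul]
    rw [Real.coe_toNNReal _ (pow_nonneg (le_of_lt hx) _)]
  · exact (measurable_subtype_coe.pow_const _).real_toNNReal

end SphereIntegral

/-! ### The divergence theorem on a ball via radial test functions -/

section DivergenceTheorem

variable {n : ℕ}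

theorem hasFDerivAt_norm_of_ne_zero {E : Type*} [NormedAddCommGroup E] [InnerProductSpace ℝ E]
    {x : E} (hx : x ≠ 0) : HasFDerivAt (fun y : E => ‖y‖) (‖x‖⁻¹ • innerSL ℝ x) x := by
  have h1 := (hasStrictFDerivAt_norm_sq x).hasFDerivAt.sqrt (by simpa using hx)
  simp only [Real.sqrt_sq (norm_nonneg _)] at h1
  convert h1 using 1
  rw [← Nat.cast_smul_eq_nsmul ℝ, smul_smul]
  congr 1
  field_simp
  norm_num

/-- A radial function whose profile has derivative `s ζ(s)` has gradient `ζ(‖x‖) x`. -/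
theorem hasFDerivAt_radial {χ ζ : ℝ → ℝ} (hχ : ∀ s, HasDerivAt χ (s * ζ s) s) (x : Eucl n) :
    HasFDerivAt (fun y : Eucl n => χ ‖y‖) (ζ ‖x‖ • innerSL ℝ x) x := by
  rcases eq_or_ne x 0 with rfl | hx
  · have h0 : HasDerivAt χ 0 0 := by simpa using hχ 0
    rw [hasDerivAt_iff_isLittleO] at h0
    rw [hasFDerivAt_iff_isLittleO]
    have h1 : Tendsto (fun y : Eucl n => ‖y‖) (𝓝 0) (𝓝 0) := by
      simpa using (continuous_norm (E := Eucl n)).tendsto 0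
    refine Asymptotics.IsLittleO.of_norm_right ?_
    simpa [Function.comp_def] using h0.comp_tendsto h1
  · have := (hχ ‖x‖).comp_hasFDerivAt x (hasFDerivAt_norm_of_ne_zero hx)
    rw [smul_smul, show ‖x‖ * ζ ‖x‖ * ‖x‖⁻¹ = ζ ‖x‖ by
      field_simp [norm_ne_zero_iff.2 hx]] at this
    exact this

theorem inner_eq_sum_mul (x y : Eucl n) : inner ℝ x y = ∑ i, x i * y i := by
  rw [PiLp.inner_apply]
  exact Finset.sum_congr rfl fun i _ => by simp [mul_comm]

/-- Integration by parts against a compactly supported radial function. -/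
theorem integral_radial_mul_divergence {G : Eucl n → Eucl n} (hG : ContDiff ℝ (⊤ : ℕ∞) G)
    {χ ζ : ℝ → ℝ} (hχ : ∀ s, HasDerivAt χ (s * ζ s) s) (hζ : Continuous ζ) {b : ℝ}
    (hχb : ∀ s, b ≤ s → χ s = 0) (hζb : ∀ s, b ≤ s → ζ s = 0) :
    Integrable (fun x => χ ‖x‖ * divergence G x) ∧
    Integrable (fun x => ζ ‖x‖ * inner ℝ (G x) x) ∧
    ∫ x, χ ‖x‖ * divergence G x = - ∫ x, ζ ‖x‖ * inner ℝ (G x) x := by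
  have hχc : Continuous χ := continuous_iff_continuousAt.2 fun s => (hχ s).continuousAt
  have hint : ∀ {κ : ℝ → ℝ} {f : Eucl n → ℝ}, Continuous κ → (∀ s, b ≤ s → κ s = 0) →
      Continuous f → Integrable (fun x => κ ‖x‖ * f x) := by
    intro κ f hκ hκb hf
    refine ((hκ.comp continuous_norm).mul hf).integrable_of_hasCompactSupport ?_
    refine HasCompactSupport.intro (isCompact_closedBall (0 : Eucl n) b) fun x hx => ?_
    simp only [Metric.mem_closedBall, dist_zero_right, not_le] at hx
    simp [hκb _ hx.le]
  have hGi : ∀ i, ContDiff ℝ (⊤ : ℕ∞) fun x => G x i := contDiff_euclidean.1 hG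
  have hdG : ∀ i x, fderiv ℝ (fun x => G x i) x (EuclideanSpace.single i 1) =
      fderiv ℝ G x (EuclideanSpace.single i 1) i := by
    intro i x
    have h1 : HasFDerivAt (fun x => G x i)
        ((EuclideanSpace.proj i : Eucl n →L[ℝ] ℝ).comp (fderiv ℝ G x)) x :=
      (EuclideanSpace.proj i : Eucl n →L[ℝ] ℝ).hasFDerivAt.comp x
        (hG.differentiable (by simp) x).hasFDerivAt
    rw [h1.fderiv]
    simp
  have hu : ∀ x : Eucl n, fderiv ℝ (fun y : Eucl n => χ ‖y‖) x = ζ ‖x‖ • innerSL ℝ x := fun x =>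
    (hasFDerivAt_radial hχ x).fderiv
  have hui : ∀ i (x : Eucl n), fderiv ℝ (fun y : Eucl n => χ ‖y‖) x (EuclideanSpace.single i 1)
      = ζ ‖x‖ * x i := by
    intro i x
    rw [hu]
    simp [EuclideanSpace.inner_single_right]
  have hdGc : ∀ i, Continuous fun x => fderiv ℝ G x (EuclideanSpace.single i 1) i := by
    intro i
    simp_rw [← hdG]
    exact ((hGi i).continuous_fderiv (by simp)).clm_apply continuous_const
  have hxi : ∀ i, Continuous fun x : Eucl n => x i := fun i =>
    (EuclideanSpace.proj i : Eucl n →L[ℝ] ℝ).continuous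
  have key : ∀ i, ∫ x, χ ‖x‖ * fderiv ℝ G x (EuclideanSpace.single i 1) i =
      - ∫ x, ζ ‖x‖ * (x i * G x i) := by
    intro i
    have := integral_mul_fderiv_eq_neg_fderiv_mul_of_integrable (μ := (volume : Measure (Eucl n)))
      (f := fun y : Eucl n => χ ‖y‖) (g := fun x => G x i) (v := EuclideanSpace.single i 1)
      (by
        simp only [hui, mul_assoc]
        exact hint hζ hζb ((hxi i).mul (hGi i).continuous))
      (by
        simp only [hdG]
        exact hint hχc hχb (hdGc i))
      (hint hχc hχb (hGi i).continuous)
      (fun x _ => (hasFDerivAt_radial hχ x).differentiableAt)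
      (fun x _ => (hGi i).differentiable (by simp) x)
    simpa only [hui, hdG, mul_assoc] using this
  refine ⟨hint hχc hχb (contDiff_divergence hG).continuous,
    hint hζ hζb (hG.continuous.inner continuous_id), ?_⟩
  simp only [divergence, Finset.mul_sum]
  rw [integral_finsetSum _ fun i _ => hint hχc hχb (hdGc i)]
  have hint2 : ∀ i, Integrable fun x => ζ ‖x‖ * (x i * G x i) := fun i =>
    hint hζ hζb ((hxi i).mul (hGi i).continuous)
  simp only [real_inner_comm, inner_eq_sum_mul, Finset.mul_sum, key]
  rw [integral_finsetSum _ fun i _ => hint2 i, Finset.sum_neg_distrib]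

/-- **Divergence theorem** for a ball. -/
theorem setIntegral_ball_divergence (hn : 0 < n) {G : Eucl n → Eucl n}
    (hG : ContDiff ℝ (⊤ : ℕ∞) G) {r : ℝ} (hr : 0 < r) :
    ∫ x in Metric.ball 0 r, divergence G x = sphereIntegral r (fun x => inner ℝ (G x) x) / r := by
  have hDivc := (contDiff_divergence hG).continuous
  set D : ℝ → ℝ := fun s => sphereIntegral s (divergence G) with hDdef
  have hD : Continuous D := continuous_sphereIntegral hDivc
  set Φ : ℝ → ℝ := fun s => sphereIntegral s fun x => inner ℝ (G x) x with hΦdef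
  have hΦ : Continuous Φ := continuous_sphereIntegral (hG.continuous.inner continuous_id)
  set P : ℝ → ℝ := fun s => ∫ t in (0 : ℝ)..s, D t with hPdef
  have hP' : ∀ s, HasDerivAt P (D s) s := fun s =>
    intervalIntegral.integral_hasDerivAt_right (hD.intervalIntegrable _ _)
      (hD.stronglyMeasurableAtFilter _ _) hD.continuousAt
  have hPc : Continuous P := continuous_iff_continuousAt.2 fun s => (hP' s).continuousAt
  -- The identity `s P(s) = Φ(s)` is proved weakly: `P` integrates the divergence over the ball of
  -- radius `s`, and `Φ / s` is the flux through its boundary.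
  have htest : ∀ ζ : ℝ → ℝ, ContDiff ℝ (⊤ : ℕ∞) ζ → HasCompactSupport ζ → tsupport ζ ⊆ Ioi 0 →
      ∫ s, ζ s • (s * P s - Φ s) = 0 := by
    intro ζ hζ hζc hζs
    obtain ⟨b₀, hb₀⟩ := hζc.isCompact.bddAbove
    set b := max b₀ 0 + 1 with hb
    have hb0 : 0 < b := by positivity
    have hζb : ∀ s, b ≤ s → ζ s = 0 := fun s hs => by
      by_contra hne
      have := hb₀ (subset_tsupport ζ hne)
      linarith [le_max_left b₀ 0]
    have hζ0 : ∀ s, s ∉ Ioi (0 : ℝ) → ζ s = 0 := fun s hs => by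
      by_contra hne
      exact hs (hζs (subset_tsupport ζ hne))
    have hsζ : Continuous fun s => s * ζ s := continuous_id.mul hζ.continuous
    -- With base point `b`, `χ` vanishes beyond `b`. The factor `t` makes the gradient of `χ(‖x‖)`
    -- equal to `ζ(‖x‖) x`, with no singularity at the origin.
    set χ : ℝ → ℝ := fun s => ∫ t in b..s, t * ζ t with hχdef
    have hχ : ∀ s, HasDerivAt χ (s * ζ s) s := fun s =>
      intervalIntegral.integral_hasDerivAt_right (hsζ.intervalIntegrable _ _)
        (hsζ.stronglyMeasurableAtFilter _ _) hsζ.continuousAt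
    have hχb : ∀ s, b ≤ s → χ s = 0 := by
      intro s hs
      rw [hχdef]
      refine (intervalIntegral.integral_congr (g := fun _ => (0 : ℝ)) fun t ht => ?_).trans
        (by simp)
      rw [uIcc_of_le hs] at ht
      simp [hζb t ht.1]
    have hχc : Continuous χ := continuous_iff_continuousAt.2 fun s => (hχ s).continuousAt
    obtain ⟨hi1, hi2, hibp⟩ := integral_radial_mul_divergence hG hχ hζ.continuous hχb hζb
    have hnorm : ∀ {κ : ℝ → ℝ} {f : Eucl n → ℝ} {s : ℝ}, s ∈ Ioi (0 : ℝ) →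
        sphereIntegral s (fun x => κ ‖x‖ * f x) = κ s * sphereIntegral s f := by
      intro κ f s hs
      rw [← sphereIntegral_const_mul]
      exact sphereIntegral_congr (le_of_lt hs) fun x hx => by rw [hx]
    rw [integral_eq_integral_sphereIntegral hn hi1, integral_eq_integral_sphereIntegral hn hi2,
      setIntegral_congr_fun measurableSet_Ioi fun s hs => hnorm hs,
      setIntegral_congr_fun measurableSet_Ioi fun s hs => hnorm hs] at hibp
    have hIoc : ∀ {κ f : ℝ → ℝ}, (∀ s, b ≤ s → κ s = 0) →
        ∫ s in Ioi (0 : ℝ), κ s * f s = ∫ s in (0 : ℝ)..b, κ s * f s := by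
      intro κ f hκ
      rw [intervalIntegral.integral_of_le hb0.le]
      refine setIntegral_eq_of_subset_of_forall_sdiff_eq_zero measurableSet_Ioi
        Ioc_subset_Ioi_self fun s hs => ?_
      have : b ≤ s := by
        by_contra hlt
        exact hs.2 ⟨hs.1, (not_le.1 hlt).le⟩
      rw [hκ s this, zero_mul]
    -- The boundary terms vanish because `χ b = 0` and `P 0 = 0`.
    have hparts : ∫ s in (0 : ℝ)..b, χ s * D s = - ∫ s in (0 : ℝ)..b, s * ζ s * P s := by
      rw [intervalIntegral.integral_mul_deriv_eq_deriv_mul (fun s _ => hχ s) (fun s _ => hP' s)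
        (hsζ.intervalIntegrable _ _) (hD.intervalIntegrable _ _)]
      simp [hχb b le_rfl, hPdef]
    have hmain : ∫ s in (0 : ℝ)..b, ζ s * (s * P s - Φ s) = 0 := by
      have h1 : ∫ s in (0 : ℝ)..b, ζ s * (s * P s - Φ s) =
          (∫ s in (0 : ℝ)..b, s * ζ s * P s) - ∫ s in (0 : ℝ)..b, ζ s * Φ s := by
        have h2 : Continuous fun s => s * ζ s * P s := hsζ.mul hPc
        have h3 : Continuous fun s => ζ s * Φ s := hζ.continuous.mul hΦ
        rw [← intervalIntegral.integral_sub (h2.intervalIntegrable _ _)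
          (h3.intervalIntegrable _ _)]
        refine intervalIntegral.integral_congr fun s _ => ?_
        ring
      rw [h1]
      rw [hIoc hχb, hIoc hζb, hparts] at hibp
      linarith
    simp only [smul_eq_mul]
    rw [← setIntegral_eq_integral_of_forall_compl_eq_zero (s := Ioi (0 : ℝ))
      (fun s hs => by rw [hζ0 s hs, zero_mul]), hIoc hζb, hmain]
  have hcont : Continuous fun s => s * P s - Φ s := (continuous_id.mul hPc).sub hΦ
  have hae := isOpen_Ioi.ae_eq_zero_of_integral_contDiff_smul_eq_zero
    (hcont.locallyIntegrable.locallyIntegrableOn _) htest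
  -- Almost everywhere equality becomes equality at every radius by continuity.
  have heq : EqOn (fun s => s * P s - Φ s) (fun _ => 0) (Ioi 0) :=
    Measure.eqOn_open_of_ae_eq ((ae_restrict_iff' measurableSet_Ioi).2 hae) isOpen_Ioi
      hcont.continuousOn continuousOn_const
  have hrP : r * P r = Φ r := sub_eq_zero.1 (heq hr)
  have hball : ∫ x in Metric.ball 0 r, divergence G x = P r := by
    rw [← integral_indicator measurableSet_ball, integral_eq_integral_sphereIntegral hn]
    · have h1 : ∀ s ∈ Ioi (0 : ℝ), sphereIntegral s ((Metric.ball (0 : Eucl n) r).indicator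
          (divergence G)) = (Iio r).indicator D s := by
        intro s hs
        by_cases hsr : s < r
        · rw [indicator_of_mem (show s ∈ Iio r from hsr)]
          exact sphereIntegral_congr (le_of_lt hs) fun x hx => by
            rw [indicator_of_mem]; simpa [hx] using hsr
        · rw [indicator_of_notMem (show s ∉ Iio r from hsr)]
          refine (sphereIntegral_congr (g := fun _ => 0) (le_of_lt hs) fun x hx => ?_).trans
            (by simp [sphereIntegral])
          rw [indicator_of_notMem]; simpa [hx] using hsr
      rw [setIntegral_congr_fun measurableSet_Ioi h1, setIntegral_indicator measurableSet_Iio,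
        hPdef]
      simp only
      rw [intervalIntegral.integral_of_le hr.le, integral_Ioc_eq_integral_Ioo]
      rfl
    · rw [integrable_indicator_iff measurableSet_ball]
      exact (hDivc.continuousOn.integrableOn_compact
        (isCompact_closedBall (0 : Eucl n) r)).mono_set Metric.ball_subset_closedBall
  rw [hball, eq_div_iff hr.ne', mul_comm, hrP]

end DivergenceTheorem

/-! ### Second and fourth moments of the sphere -/

section Moments

variable {n : ℕ}

theorem contDiff_coord (i : Fin n) : ContDiff ℝ (⊤ : ℕ∞) fun x : Eucl n => x i :=
  (EuclideanSpace.proj i : Eucl n →L[ℝ] ℝ).contDiff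

theorem continuous_coord (i : Fin n) : Continuous fun x : Eucl n => x i :=
  (contDiff_coord i).continuous

theorem hasFDerivAt_coord (i : Fin n) (x : Eucl n) :
    HasFDerivAt (fun x : Eucl n => x i) (EuclideanSpace.proj i : Eucl n →L[ℝ] ℝ) x :=
  (EuclideanSpace.proj i : Eucl n →L[ℝ] ℝ).hasFDerivAt

theorem norm_sq_eq_sum_sq (x : Eucl n) : ‖x‖ ^ 2 = ∑ i, x i ^ 2 := by
  rw [EuclideanSpace.norm_sq_eq]
  simp

theorem divergence_smul_single {g : Eucl n → ℝ} {x : Eucl n} (hg : DifferentiableAt ℝ g x)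
    (i : Fin n) :
    divergence (fun y => g y • EuclideanSpace.single i (1 : ℝ)) x =
      fderiv ℝ g x (EuclideanSpace.single i 1) := by
  rw [divergence_smul hg (differentiableAt_const _)]
  simp [divergence]

/-- Integrating a partial derivative over a ball. -/
theorem setIntegral_ball_fderiv_single (hn : 0 < n) {g : Eucl n → ℝ}
    (hg : ContDiff ℝ (⊤ : ℕ∞) g) (i : Fin n) {r : ℝ} (hr : 0 < r) :
    ∫ x in Metric.ball 0 r, fderiv ℝ g x (EuclideanSpace.single i 1) =
      sphereIntegral r (fun x => g x * x i) / r := by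
  rw [← sphereIntegral_congr (f := fun x => inner ℝ (g x • EuclideanSpace.single i (1 : ℝ)) x) hr.le
      fun x _ => by simp [real_inner_smul_left, EuclideanSpace.inner_single_left],
    ← setIntegral_ball_divergence (G := fun x => g x • EuclideanSpace.single i (1 : ℝ)) hn
      (hg.smul contDiff_const) hr]
  simp_rw [divergence_smul_single (hg.differentiable (by simp) _)]

theorem sphereIntegral_const (r c : ℝ) :
    sphereIntegral r (fun _ : Eucl n => c) = c * (r ^ (n - 1) * sphereVol n) := by
  simp only [sphereIntegral, sphereVol, integral_const, smul_eq_mul]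
  ring

/-- The divergence theorem for `x_j e_j` makes the value `r` times the volume of the ball, the same
for each `j`; the sum over `j` is `r²` times the area. -/
theorem sphereIntegral_coord_sq_eq (hn : 0 < n) {r : ℝ} (hr : 0 < r) (i : Fin n) :
    sphereIntegral r (fun x : Eucl n => x i ^ 2) = r ^ (n + 1) * sphereVol n / n := by
  have h : ∀ j, sphereIntegral r (fun x : Eucl n => x j ^ 2) =
      r * (volume : Measure (Eucl n)).real (Metric.ball 0 r) := by
    intro j
    have := setIntegral_ball_fderiv_single hn (contDiff_coord j) j hr
    simp only [(hasFDerivAt_coord j _).fderiv] at this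
    simp only [PiLp.proj_apply, PiLp.single_apply, if_true, setIntegral_const,
      smul_eq_mul, mul_one] at this
    rw [this, mul_div_cancel₀ _ hr.ne']
    congr 1; ext x; ring
  have hsum : ∑ j, sphereIntegral r (fun x : Eucl n => x j ^ 2) =
      r ^ 2 * (r ^ (n - 1) * sphereVol n) := by
    rw [← sphereIntegral_const, ← sphereIntegral_sum (f := fun j (x : Eucl n) => x j ^ 2)
      _ _ fun j _ => (continuous_coord j).pow 2]
    exact sphereIntegral_congr hr.le fun x hx => by rw [← norm_sq_eq_sum_sq, hx]
  have hn' : (n : ℝ) ≠ 0 := by exact_mod_cast hn.ne'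
  rw [eq_div_iff hn', h i]
  simp only [h, Finset.sum_const, Finset.card_univ, Fintype.card_fin, nsmul_eq_mul] at hsum
  rw [mul_comm, hsum, ← mul_assoc, ← pow_add]
  congr 2
  omega

/-- The fourth-order moment `∫ x_i² x_j²` of the sphere of radius `r`, for `i ≠ j`. -/
def mixedMoment (n : ℕ) (r : ℝ) : ℝ := r ^ (n + 3) * sphereVol n / (n * (n + 2))

theorem sphereIntegral_coord_sq (hn : 0 < n) {r : ℝ} (hr : 0 < r) (i : Fin n) :
    sphereIntegral r (fun x : Eucl n => x i ^ 2) = (n + 2) * mixedMoment n r / r ^ 2 := by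
  rw [sphereIntegral_coord_sq_eq hn hr, mixedMoment]
  have hn' : (n : ℝ) ≠ 0 := by exact_mod_cast hn.ne'
  field_simp
  ring

/-- The field `x_i² x` has divergence `(n + 2) x_i²` and flux `r ∫ x_i²` through the sphere. -/
theorem setIntegral_ball_coord_sq (hn : 0 < n) {r : ℝ} (hr : 0 < r) (i : Fin n) :
    ∫ x in Metric.ball (0 : Eucl n) r, x i ^ 2 = mixedMoment n r / r := by
  have hd : ∀ x : Eucl n, divergence (fun y => y i ^ 2 • y) x = (n + 2) * x i ^ 2 := by
    intro x
    rw [divergence_smul (((contDiff_coord i).pow 2).differentiable (by simp) x)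
      differentiableAt_fun_id, ((hasFDerivAt_coord i x).pow 2).fderiv]
    simp [divergence]
    ring
  have h := setIntegral_ball_divergence (G := fun x : Eucl n => x i ^ 2 • x) hn
    (((contDiff_coord i).pow 2).smul contDiff_id) hr
  have h2 : sphereIntegral r (fun x : Eucl n => inner ℝ (x i ^ 2 • x) x) =
      r ^ 2 * sphereIntegral r (fun x : Eucl n => x i ^ 2) := by
    rw [← sphereIntegral_const_mul]
    exact sphereIntegral_congr hr.le fun x hx => by
      rw [real_inner_smul_left, real_inner_self_eq_norm_sq, hx]; ring
  simp only [hd] at h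
  rw [h2, integral_const_mul, sphereIntegral_coord_sq hn hr] at h
  have hn' : (n : ℝ) + 2 ≠ 0 := by positivity
  refine mul_left_cancel₀ hn' (h.trans ?_)
  field_simp

/-- This is the divergence theorem for `x_i² x_j e_j`, whose divergence is `x_i²` or, when `i = j`,
`3 x_i²`. -/
theorem sphereIntegral_coord_sq_mul_coord_sq (hn : 0 < n) {r : ℝ} (hr : 0 < r) (i j : Fin n) :
    sphereIntegral r (fun x : Eucl n => x i ^ 2 * x j ^ 2) =
      mixedMoment n r * (if i = j then 3 else 1) := by
  have h := setIntegral_ball_fderiv_single hn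
    (((contDiff_coord i).pow 2).mul (contDiff_coord j)) j hr
  have hd : ∀ x : Eucl n, fderiv ℝ (fun x : Eucl n => x i ^ 2 * x j) x
      (EuclideanSpace.single j 1) = (if i = j then 3 else 1) * x i ^ 2 := by
    intro x
    rw [(((hasFDerivAt_coord i x).pow 2).fun_mul (hasFDerivAt_coord j x)).fderiv]
    by_cases hij : i = j
    · subst hij; simp; ring
    · simp [hij]
  simp only [hd] at h
  rw [integral_const_mul, setIntegral_ball_coord_sq hn hr, eq_div_iff hr.ne'] at h
  rw [show (fun x : Eucl n => x i ^ 2 * x j ^ 2) = fun x => x i ^ 2 * x j * x j by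
    ext x; ring, ← h]
  field_simp

end Moments

/-! ### The Gaussian density and its moments -/

section Gaussian

variable {n : ℕ}

theorem gaussDensity_eq (x : Eucl n) : gaussDensity n x =
    ((2 * Real.pi) ^ ((n : ℝ) / 2))⁻¹ * Real.exp (-(1 / 2) * ‖x‖ ^ 2) := by
  rw [gaussDensity, div_eq_inv_mul]
  congr 2
  ring

theorem contDiff_gaussDensity : ContDiff ℝ (⊤ : ℕ∞) (gaussDensity n) := by
  have : gaussDensity n = fun x => ((2 * Real.pi) ^ ((n : ℝ) / 2))⁻¹ *
      Real.exp (-(1 / 2) * ‖x‖ ^ 2) := funext gaussDensity_eq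
  rw [this]
  exact contDiff_const.mul (contDiff_const.mul (contDiff_norm_sq ℝ)).exp

theorem gaussDensity_pos (x : Eucl n) : 0 < gaussDensity n x := by
  unfold gaussDensity
  positivity

theorem fderiv_gaussDensity (x v : Eucl n) :
    fderiv ℝ (gaussDensity n) x v = -(inner ℝ x v) * gaussDensity n x := by
  have h1 := (((hasStrictFDerivAt_norm_sq x).hasFDerivAt.const_mul (-(1 / 2) : ℝ)).exp).const_mul
    ((2 * Real.pi) ^ ((n : ℝ) / 2))⁻¹
  rw [← funext (gaussDensity_eq (n := n))] at h1
  rw [h1.fderiv, gaussDensity_eq]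
  simp
  ring

theorem integrable_gaussDensity : Integrable (gaussDensity n) := by
  have h := GaussianFourier.integral_rexp_neg_mul_sq_norm (V := Eucl n) (b := 1 / 2) (by norm_num)
  have h1 : Integrable fun x : Eucl n => Real.exp (-(1 / 2) * ‖x‖ ^ 2) := by
    -- A nonintegrable function has integral `0` by convention, whereas the Gaussian integral is
    -- positive.
    by_contra hni
    rw [integral_undef hni] at h
    exact absurd h (ne_of_lt (by positivity))
  simp only [funext gaussDensity_eq]
  exact h1.const_mul _

theorem integrable_coord_sq_mul_gaussDensity (i : Fin n) :
    Integrable fun x : Eucl n => x i ^ 2 * gaussDensity n x := by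
  -- Half of the exponent is spent on absorbing `x_i²`, which leaves the dominating Gaussian with
  -- parameter `1 / 4`.
  have h := GaussianFourier.integral_rexp_neg_mul_sq_norm (V := Eucl n) (b := 1 / 4) (by norm_num)
  have h1 : Integrable fun x : Eucl n => Real.exp (-(1 / 4) * ‖x‖ ^ 2) := by
    by_contra hni
    rw [integral_undef hni] at h
    exact absurd h (ne_of_lt (by positivity))
  refine (h1.const_mul (((2 * Real.pi) ^ ((n : ℝ) / 2))⁻¹ * 4)).mono'
    (((continuous_coord i).pow 2).mul contDiff_gaussDensity.continuous).aestronglyMeasurable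
    (Eventually.of_forall fun x => ?_)
  rw [Real.norm_of_nonneg (mul_nonneg (sq_nonneg _) (gaussDensity_pos x).le), gaussDensity_eq]
  have h2 : x i ^ 2 ≤ ‖x‖ ^ 2 := by
    rw [← sq_abs]
    gcongr
    exact PiLp.norm_apply_le x i
  have h3 : ‖x‖ ^ 2 / 4 ≤ Real.exp (‖x‖ ^ 2 / 4) := by
    linarith [Real.add_one_le_exp (‖x‖ ^ 2 / 4)]
  have h4 : Real.exp (-(1 / 2) * ‖x‖ ^ 2) * Real.exp (‖x‖ ^ 2 / 4) =
      Real.exp (-(1 / 4) * ‖x‖ ^ 2) := by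
    rw [← Real.exp_add]; congr 1; ring
  rw [← h4]
  calc x i ^ 2 * (((2 * Real.pi) ^ ((n : ℝ) / 2))⁻¹ * Real.exp (-(1 / 2) * ‖x‖ ^ 2))
      ≤ (4 * Real.exp (‖x‖ ^ 2 / 4)) *
        (((2 * Real.pi) ^ ((n : ℝ) / 2))⁻¹ * Real.exp (-(1 / 2) * ‖x‖ ^ 2)) := by
        gcongr; linarith
    _ = _ := by ring

theorem setIntegral_gaussMeasure (S : Set (Eucl n)) (f : Eucl n → ℝ) :
    ∫ x in S, f x ∂(gaussMeasure n) = ∫ x in S, f x * gaussDensity n x := by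
  rw [gaussMeasure, setIntegral_withDensity_eq_setIntegral_toReal_smul' S
    (contDiff_gaussDensity.continuous.measurable.ennreal_ofReal)
    (Eventually.of_forall fun _ => ENNReal.ofReal_lt_top)]
  refine integral_congr_ae (Eventually.of_forall fun x => ?_)
  simp only [ENNReal.toReal_ofReal (gaussDensity_pos x).le, smul_eq_mul]
  ring

theorem gaussMeasure_real (S : Set (Eucl n)) :
    (gaussMeasure n).real S = ∫ x in S, gaussDensity n x := by
  have := setIntegral_gaussMeasure S fun _ => (1 : ℝ)
  simpa using this

instance : IsFiniteMeasure (gaussMeasure n) :=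
  isFiniteMeasure_withDensity_ofReal integrable_gaussDensity.2

theorem integrable_one_sub_coord_sq (i : Fin n) :
    Integrable (fun x : Eucl n => (1 - x i ^ 2) * gaussDensity n x) := by
  simp only [sub_mul, one_mul]
  exact integrable_gaussDensity.sub (integrable_coord_sq_mul_gaussDensity i)

/-- The integrand is the partial derivative of `x_i γ`. This vanishing is what makes `fourierF`
insensitive to complements. -/
theorem integral_one_sub_coord_sq (i : Fin n) :
    ∫ x : Eucl n, (1 - x i ^ 2) * gaussDensity n x = 0 := by
  have hxi : ∀ x : Eucl n, fderiv ℝ (fun x : Eucl n => x i) x (EuclideanSpace.single i 1) = 1 := by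
    intro x
    rw [(hasFDerivAt_coord i x).fderiv]
    simp
  have hρ : ∀ x : Eucl n, fderiv ℝ (gaussDensity n) x (EuclideanSpace.single i 1) =
      -(x i * gaussDensity n x) := by
    intro x
    rw [fderiv_gaussDensity]
    simp [EuclideanSpace.inner_single_right]
  have hint : ∀ x : Eucl n, x i * -(x i * gaussDensity n x) = -(x i ^ 2 * gaussDensity n x) :=
    fun x => by ring
  have h := integral_mul_fderiv_eq_neg_fderiv_mul_of_integrable (μ := (volume : Measure (Eucl n)))
    (f := fun x : Eucl n => x i) (g := gaussDensity n) (v := EuclideanSpace.single i 1)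
    (by simpa only [hxi, one_mul] using integrable_gaussDensity)
    (by
      simp only [hρ, hint]
      exact (integrable_coord_sq_mul_gaussDensity i).neg)
    (by
      refine (integrable_gaussDensity.add (integrable_coord_sq_mul_gaussDensity i)).mono'
        ((continuous_coord i).mul contDiff_gaussDensity.continuous).aestronglyMeasurable
        (Eventually.of_forall fun x => ?_)
      have h1 := gaussDensity_pos x
      rw [norm_mul, Real.norm_of_nonneg h1.le, Real.norm_eq_abs, Pi.add_apply]
      have h2 : |x i| ≤ 1 + x i ^ 2 := by rw [← sq_abs]; nlinarith [sq_nonneg (|x i| - 1)]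
      nlinarith [mul_le_mul_of_nonneg_right h2 h1.le])
    (fun x _ => (hasFDerivAt_coord i x).differentiableAt)
    (fun x _ => contDiff_gaussDensity.differentiable (by simp) x)
  simp only [hxi, hρ, hint, one_mul, integral_neg, neg_inj] at h
  simp only [sub_mul, one_mul]
  rw [integral_sub integrable_gaussDensity (integrable_coord_sq_mul_gaussDensity i), h, sub_self]

end Gaussian

/-! ### Calculus of second derivatives -/

section SecondDerivative

variable {φ ψ φ' : ℝ → ℝ} {d e t : ℝ}

theorem hasSecondDerivAt_of_eventually (h : ∀ᶠ s in 𝓝 t, HasDerivAt φ (φ' s) s)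
    (h' : HasDerivAt φ' d t) : HasSecondDerivAt φ d t :=
  ⟨h.mono fun _ hs => hs.differentiableAt,
    h'.congr_of_eventuallyEq (h.mono fun _ hs => hs.deriv)⟩

theorem HasSecondDerivAt.congr_of_eventuallyEq (h : HasSecondDerivAt φ d t) (hψ : ψ =ᶠ[𝓝 t] φ) :
    HasSecondDerivAt ψ d t := by
  refine ⟨?_, h.2.congr_of_eventuallyEq hψ.deriv⟩
  filter_upwards [h.1, hψ.eventually_nhds] with s hs he
  exact hs.congr_of_eventuallyEq he

theorem HasSecondDerivAt.unique (h : HasSecondDerivAt φ d t) (h' : HasSecondDerivAt φ e t) :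
    d = e := h.2.unique h'.2

theorem HasSecondDerivAt.const_add_const_mul (h : HasSecondDerivAt φ d t) (c σ : ℝ) :
    HasSecondDerivAt (fun s => c + σ * φ s) (σ * d) t :=
  hasSecondDerivAt_of_eventually (h.1.mono fun _ hs => (hs.hasDerivAt.const_mul σ).const_add c)
    (h.2.const_mul σ)

theorem hasSecondDerivAt_sum_sq {ι : Type*} (s : Finset ι) {φ : ι → ℝ → ℝ} {d₁ d₂ : ι → ℝ}
    (h₁ : ∀ i, HasDerivAt (φ i) (d₁ i) t) (h₂ : ∀ i, HasSecondDerivAt (φ i) (d₂ i) t) :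
    HasSecondDerivAt (fun u => ∑ i ∈ s, φ i u ^ 2)
      (∑ i ∈ s, 2 * (d₁ i ^ 2 + φ i t * d₂ i)) t := by
  refine hasSecondDerivAt_of_eventually (φ' := fun u => ∑ i ∈ s, 2 * (φ i u * deriv (φ i) u))
    ?_ ?_
  · have : ∀ᶠ u in 𝓝 t, ∀ i ∈ s, DifferentiableAt ℝ (φ i) u :=
      (Filter.eventually_all_finset s).2 fun i _ => (h₂ i).1
    filter_upwards [this] with u hu
    refine HasDerivAt.fun_sum fun i hi => ?_
    refine ((hu i hi).hasDerivAt.fun_pow 2).congr_deriv ?_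
    simp [mul_assoc]
  · refine HasDerivAt.fun_sum fun i _ => ?_
    refine (((h₁ i).fun_mul (h₂ i).2).const_mul 2).congr_deriv ?_
    rw [(h₁ i).deriv]
    ring

end SecondDerivative

/-! ### Variations of integrals over the ball and reduction of the complement -/

namespace IsFlowOf

variable {n : ℕ} {X : Eucl n → Eucl n} {Ψ : Eucl n → ℝ → Eucl n}

theorem setIntegral_flowSet_zero (h : IsFlowOf X Ψ) (r : ℝ) (g : Eucl n → ℝ) :
    ∫ x in flowSet Ψ (Metric.ball 0 r) 0, g x = ∫ x in Metric.ball 0 r, g x := by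
  simp [flowSet, h.initial]

theorem setIntegral_ball_divergence_smul (h : IsFlowOf X Ψ) (hn : 0 < n) {r : ℝ} (hr : 0 < r)
    {g : Eucl n → ℝ} (hg : ContDiff ℝ (⊤ : ℕ∞) g) :
    ∫ x in Metric.ball 0 r, divergence (fun y => g y • X y) x =
      sphereIntegral r (fun x => g x * (inner ℝ (X x) x / r)) := by
  rw [setIntegral_ball_divergence (G := fun y => g y • X y) hn (hg.smul h.smooth) hr, div_eq_inv_mul,
    ← sphereIntegral_const_mul]
  congr 1
  ext x
  rw [real_inner_smul_left]
  ring

/-- First variation of the integral of `g` over a ball. -/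
theorem hasDerivAt_setIntegral_ball (h : IsFlowOf X Ψ) (hn : 0 < n) {r : ℝ} (hr : 0 < r)
    {g : Eucl n → ℝ} (hg : ContDiff ℝ (⊤ : ℕ∞) g) :
    HasDerivAt (fun t => ∫ x in flowSet Ψ (Metric.ball 0 r) t, g x)
      (sphereIntegral r (fun x => g x * (inner ℝ (X x) x / r))) 0 := by
  have := (h.eventually_hasDerivAt_setIntegral_flowSet r hg).self_of_nhds
  rwa [h.setIntegral_flowSet_zero, h.setIntegral_ball_divergence_smul hn hr hg] at this

/-- Second variation of the integral of `g` over a ball. -/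
theorem hasSecondDerivAt_setIntegral_ball (h : IsFlowOf X Ψ) (hn : 0 < n) {r : ℝ} (hr : 0 < r)
    {g : Eucl n → ℝ} (hg : ContDiff ℝ (⊤ : ℕ∞) g) :
    HasSecondDerivAt (fun t => ∫ x in flowSet Ψ (Metric.ball 0 r) t, g x)
      (sphereIntegral r
        (fun x => divergence (fun y => g y • X y) x * (inner ℝ (X x) x / r))) 0 :=
  hasSecondDerivAt_of_eventually (h.eventually_hasDerivAt_setIntegral_flowSet r hg)
    (h.hasDerivAt_setIntegral_ball hn hr (contDiff_divergence (hg.smul h.smooth)))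

/-- An affine relation with nonzero slope treats the ball and its complement together: vanishing of
the first two derivatives is the same condition for both. -/
theorem eventually_gaussMeasure_real (h : IsFlowOf X Ψ) {r : ℝ} {A : Set (Eucl n)}
    {N : Eucl n → Eucl n} (hA : IsBallOrComplWithNormal r A N) :
    ∃ c σ : ℝ, σ ≠ 0 ∧ ∀ᶠ t in 𝓝 (0 : ℝ), (gaussMeasure n).real (flowSet Ψ A t) =
      c + σ * ∫ x in flowSet Ψ (Metric.ball 0 r) t, gaussDensity n x := by
  rcases hA with ⟨rfl, -⟩ | ⟨rfl, -⟩
  · exact ⟨0, 1, one_ne_zero, Eventually.of_forall fun t => by rw [gaussMeasure_real]; ring⟩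
  · refine ⟨∫ x, gaussDensity n x, -1, by norm_num, ?_⟩
    filter_upwards [h.eventually_measurableSet_flowSet r,
      Ioo_mem_nhds (show (-1 : ℝ) < 0 by norm_num) one_pos] with t hm ht
    rw [gaussMeasure_real, h.flowSet_compl _ ht, setIntegral_compl
      (hm _ Subset.rfl measurableSet_ball) integrable_gaussDensity]
    ring

theorem eventually_fourierF (h : IsFlowOf X Ψ) {r : ℝ} {A : Set (Eucl n)}
    {N : Eucl n → Eucl n} (hA : IsBallOrComplWithNormal r A N) :
    ∀ᶠ t in 𝓝 (0 : ℝ), fourierF (flowSet Ψ A t) =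
      ∑ i, (∫ x in flowSet Ψ (Metric.ball 0 r) t, (1 - x i ^ 2) * gaussDensity n x) ^ 2 := by
  rcases hA with ⟨rfl, -⟩ | ⟨rfl, -⟩
  · exact Eventually.of_forall fun t => by simp only [fourierF, setIntegral_gaussMeasure]
  · filter_upwards [h.eventually_measurableSet_flowSet r,
      Ioo_mem_nhds (show (-1 : ℝ) < 0 by norm_num) one_pos] with t hm ht
    simp only [fourierF, setIntegral_gaussMeasure]
    refine Finset.sum_congr rfl fun i _ => ?_
    rw [h.flowSet_compl _ ht, setIntegral_compl
      (hm _ Subset.rfl measurableSet_ball) (integrable_one_sub_coord_sq i),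
      integral_one_sub_coord_sq, zero_sub, neg_sq]

end IsFlowOf

/-! ### The moment inequality on the sphere -/

section

variable {n : ℕ}

/-- The value of the Gaussian density on the sphere of radius `r`. -/
def gaussProfile (n : ℕ) (r : ℝ) : ℝ := Real.exp (-(r ^ 2 / 2)) / (2 * Real.pi) ^ ((n : ℝ) / 2)

theorem gaussDensity_of_norm_eq {r : ℝ} {x : Eucl n} (hx : ‖x‖ = r) :
    gaussDensity n x = gaussProfile n r := by
  rw [gaussDensity, gaussProfile, hx]

theorem gaussProfile_pos (n : ℕ) (r : ℝ) : 0 < gaussProfile n r := by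
  unfold gaussProfile
  positivity

theorem gaussProfile_sq (n : ℕ) (r : ℝ) :
    gaussProfile n r ^ 2 = Real.exp (-r ^ 2) / (2 * Real.pi) ^ n := by
  rw [gaussProfile, div_pow, ← Real.exp_nat_mul]
  congr 1
  · congr 1; push_cast; ring
  · rw [← Real.rpow_natCast, ← Real.rpow_natCast, ← Real.rpow_mul (by positivity)]
    congr 1; push_cast; ring

theorem sphereVol_pos (hn : 0 < n) : 0 < sphereVol n := by
  have : NeZero n := ⟨hn.ne'⟩
  rw [sphereVol, Measure.toSphere_real_apply_univ, finrank_euclideanSpace, Fintype.card_fin]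
  have : 0 < (volume : Measure (Eucl n)).real (Metric.ball 0 1) :=
    ENNReal.toReal_pos (Metric.measure_ball_pos _ _ one_pos).ne' measure_ball_lt_top.ne
  have : (0 : ℝ) < n := by exact_mod_cast hn
  positivity

theorem mixedMoment_pos (hn : 0 < n) {r : ℝ} (hr : 0 < r) : 0 < mixedMoment n r := by
  have := sphereVol_pos hn
  have : (0 : ℝ) < n := by exact_mod_cast hn
  unfold mixedMoment
  positivity

theorem variationConst_eq (hn : 0 < n) {r : ℝ} (hr : 0 < r) : variationConst n r =
    2 * mixedMoment n r * gaussProfile n r ^ 2 / r ^ 2 * (r ^ 2 - n - 2) := by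
  have : (0 : ℝ) < n := by exact_mod_cast hn
  rw [gaussProfile_sq, variationConst, mixedMoment]
  field_simp
  ring

theorem sphereIntegral_nonneg {r : ℝ} (hr : 0 ≤ r) {f : Eucl n → ℝ} (hf : ∀ x, 0 ≤ f x) :
    0 ≤ sphereIntegral r f :=
  mul_nonneg (pow_nonneg hr _) (integral_nonneg fun _ => hf _)

theorem sphereIntegral_pos {r : ℝ} (hr : 0 < r) {f : Eucl n → ℝ} (hc : Continuous f)
    (hf : ∀ x, 0 ≤ f x) {x : Eucl n} (hx : ‖x‖ = r) (hfx : f x ≠ 0) :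
    0 < sphereIntegral r f := by
  refine mul_pos (pow_pos hr _) ?_
  have hc' : Continuous fun θ : Metric.sphere (0 : Eucl n) 1 => f (r • (θ : Eucl n)) :=
    hc.comp (continuous_subtype_val.const_smul r)
  refine hc'.integral_pos_of_hasCompactSupport_nonneg_nonzero
    (HasCompactSupport.of_compactSpace _) (fun _ => hf _)
    (x := ⟨r⁻¹ • x, by simp [norm_smul, hx, abs_of_pos hr, hr.ne']⟩) ?_
  simpa [smul_smul, hr.ne'] using hfx

/-- The sum of the squared quadratic moments of a mean-zero function on the sphere. -/
theorem sum_sq_moment_le (hn : 0 < n) {r : ℝ} (hr : 0 < r) {f : Eucl n → ℝ} (hf : Continuous f)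
    (hf0 : sphereIntegral r f = 0) :
    ∑ i, sphereIntegral r (fun x => x i ^ 2 * f x) ^ 2 ≤
      2 * mixedMoment n r * sphereIntegral r (fun x => f x ^ 2) := by
  set κ := mixedMoment n r with hκ
  have hκ0 : 0 < κ := mixedMoment_pos hn hr
  set a : Fin n → ℝ := fun i => sphereIntegral r fun x => x i ^ 2 * f x with ha
  have hc : ∀ i, Continuous fun x : Eucl n => x i ^ 2 := fun i => (continuous_coord i).pow 2
  have hcc : ∀ i j, Continuous fun x : Eucl n => x i ^ 2 * x j ^ 2 := fun i j => (hc i).mul (hc j)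
  have hci : ∀ i, Continuous fun x : Eucl n => x i ^ 2 * f x := fun i => (hc i).mul hf
  have hf2 : Continuous fun x => f x ^ 2 := hf.pow 2
  have hsum : ∑ i, a i = 0 := by
    rw [ha, ← sphereIntegral_sum _ _ fun i _ => hci i, ← mul_zero (r ^ 2), ← hf0,
      ← sphereIntegral_const_mul]
    exact sphereIntegral_congr hr.le fun x hx => by
      simp only [← Finset.sum_mul, ← norm_sq_eq_sum_sq, hx]
  -- Since `∑ a_j = 0`, the constant part of the moment matrix drops out and only its diagonal
  -- excess `2κ` survives.
  have hpp : sphereIntegral r (fun x => ∑ i, ∑ j, a i * a j * (x i ^ 2 * x j ^ 2)) =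
      2 * κ * ∑ i, a i ^ 2 := by
    rw [sphereIntegral_sum _ _ fun i _ => continuous_finsetSum _ fun j _ =>
      (hcc i j).const_mul _]
    have h1 : ∀ i, sphereIntegral r (fun x => ∑ j, a i * a j * (x i ^ 2 * x j ^ 2)) =
        κ * (a i * ∑ j, a j) + 2 * κ * a i ^ 2 := by
      intro i
      rw [sphereIntegral_sum _ _ fun j _ => (hcc i j).const_mul _]
      simp only [sphereIntegral_const_mul, sphereIntegral_coord_sq_mul_coord_sq hn hr]
      have h2 : ∀ j, a i * a j * (κ * if i = j then 3 else 1) =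
          κ * (a i * a j) + if i = j then 2 * κ * (a i * a j) else 0 := by
        intro j; split_ifs <;> ring
      simp only [← hκ, h2, Finset.sum_add_distrib, Finset.sum_ite_eq, Finset.mem_univ, if_true,
        Finset.mul_sum]
      ring
    simp only [h1, hsum, mul_zero, zero_add, Finset.mul_sum]
  have hpf : sphereIntegral r (fun x => ∑ i, a i * (x i ^ 2 * f x)) = ∑ i, a i ^ 2 := by
    rw [sphereIntegral_sum _ _ fun i _ => (hci i).const_mul _]
    simp only [sphereIntegral_const_mul, sq, ha]
  have hcf : Continuous fun x => ∑ i, a i * (x i ^ 2 * f x) :=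
    continuous_finsetSum _ fun i _ => (hci i).const_mul _
  have hcp : Continuous fun x : Eucl n => ∑ i, ∑ j, a i * a j * (x i ^ 2 * x j ^ 2) :=
    continuous_finsetSum _ fun i _ => continuous_finsetSum _ fun j _ =>
      (hcc i j).const_mul _
  have hexp : ∀ x : Eucl n, (∑ i, a i * x i ^ 2 - 2 * κ * f x) ^ 2 =
      ∑ i, ∑ j, a i * a j * (x i ^ 2 * x j ^ 2) + (-4 * κ * ∑ i, a i * (x i ^ 2 * f x)
        + 4 * κ ^ 2 * f x ^ 2) := by
    intro x
    have h1 : ∑ i, ∑ j, a i * a j * (x i ^ 2 * x j ^ 2) = (∑ i, a i * x i ^ 2) ^ 2 := by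
      rw [sq, Finset.sum_mul_sum]
      exact Finset.sum_congr rfl fun i _ => Finset.sum_congr rfl fun j _ => by ring
    have h2 : ∑ i, a i * (x i ^ 2 * f x) = (∑ i, a i * x i ^ 2) * f x := by
      rw [Finset.sum_mul]
      exact Finset.sum_congr rfl fun i _ => by ring
    rw [h1, h2]
    ring
  have hcfs : Continuous fun x : Eucl n =>
      -4 * κ * ∑ i, a i * (x i ^ 2 * f x) + 4 * κ ^ 2 * f x ^ 2 :=
    (hcf.const_mul _).add (hf2.const_mul _)
  -- With `p = ∑ a_i x_i²`, both `∫ p²` and `2κ ∫ p f` equal `2κ ∑ a_i²`, so `∫ (p - 2κ f)² ≥ 0` is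
  -- the claim multiplied by `2κ`.
  have hnn := sphereIntegral_nonneg hr.le fun x : Eucl n =>
    sq_nonneg (∑ i, a i * x i ^ 2 - 2 * κ * f x)
  simp only [hexp] at hnn
  rw [sphereIntegral_add r hcp hcfs,
    sphereIntegral_add r (hcf.const_mul _) (hf2.const_mul _), sphereIntegral_const_mul,
    sphereIntegral_const_mul, hpp, hpf] at hnn
  have : 0 ≤ 2 * κ * (2 * κ * sphereIntegral r (fun x => f x ^ 2) - ∑ i, a i ^ 2) := by
    linarith
  have := nonneg_of_mul_nonneg_right this (by positivity)
  linarith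

theorem zonalForm_eq (k : Fin n) (x : Eucl n) : zonalForm k x = n * x k ^ 2 - ‖x‖ ^ 2 := by
  rw [zonalForm, norm_sq_eq_sum_sq, ← Finset.add_sum_erase _ _ (Finset.mem_univ k)]
  ring

/-- Equality case of `sum_sq_moment_le`. -/
theorem sum_sq_moment_eq (hn : 0 < n) {r : ℝ} (hr : 0 < r) {f : Eucl n → ℝ} (hf : Continuous f)
    (hf0 : sphereIntegral r f = 0) (k : Fin n) {c : ℝ} (hfk : ∀ x, ‖x‖ = r → f x = c * zonalForm k x) :
    ∑ i, sphereIntegral r (fun x => x i ^ 2 * f x) ^ 2 =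
      2 * mixedMoment n r * sphereIntegral r (fun x => f x ^ 2) := by
  set κ := mixedMoment n r with hκ
  have hc : ∀ i, Continuous fun x : Eucl n => x i ^ 2 := fun i => (continuous_coord i).pow 2
  have hcc : ∀ i j, Continuous fun x : Eucl n => x i ^ 2 * x j ^ 2 := fun i j => (hc i).mul (hc j)
  have hci : ∀ i, Continuous fun x : Eucl n => x i ^ 2 * f x := fun i => (hc i).mul hf
  have ha : ∀ i, sphereIntegral r (fun x => x i ^ 2 * f x) =
      2 * c * κ * ((if i = k then (n : ℝ) else 0) - 1) := by
    intro i
    rw [sphereIntegral_congr (g := fun x : Eucl n =>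
      c * n * (x i ^ 2 * x k ^ 2) + -(c * r ^ 2) * x i ^ 2) hr.le fun x hx => by
        rw [hfk x hx, zonalForm_eq, hx]; ring,
      sphereIntegral_add r ((hcc i k).const_mul _) ((hc i).const_mul _),
      sphereIntegral_const_mul, sphereIntegral_const_mul,
      sphereIntegral_coord_sq_mul_coord_sq hn hr, sphereIntegral_coord_sq hn hr, ← hκ]
    split_ifs <;> field_simp <;> ring
  -- Replacing one factor of `f²` by `c q_k` reduces the integral to the moment with index `k`, as
  -- `f` has mean zero.
  have hff : sphereIntegral r (fun x => f x ^ 2) = 2 * c ^ 2 * κ * (n * (n - 1)) := by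
    rw [sphereIntegral_congr (g := fun x : Eucl n =>
      c * n * (x k ^ 2 * f x) + -(c * r ^ 2) * f x) hr.le fun x hx => by
        rw [sq, show f x * f x = (c * zonalForm k x) * f x by rw [← hfk x hx], zonalForm_eq, hx]
        ring,
      sphereIntegral_add r ((hci k).const_mul _) (hf.const_mul _),
      sphereIntegral_const_mul, sphereIntegral_const_mul, hf0, ha k, if_pos rfl]
    ring
  simp only [ha, hff]
  have h1 : ∀ i : Fin n, (2 * c * κ * ((if i = k then (n : ℝ) else 0) - 1)) ^ 2 =
      4 * c ^ 2 * κ ^ 2 * ((if i = k then (n : ℝ) ^ 2 - 2 * n else 0) + 1) := by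
    intro i; split_ifs <;> ring
  simp only [h1, ← Finset.mul_sum, Finset.sum_add_distrib, Finset.sum_ite_eq', Finset.mem_univ,
    if_true, Finset.sum_const, Finset.card_univ, Fintype.card_fin, nsmul_eq_mul, mul_one]
  ring

end

/-- The integrand is the partial derivative of `x_i γ`, and `γ` is constant on the sphere. The value
does not depend on `i`. -/
theorem setIntegral_ball_one_sub_coord_sq {n : ℕ} (hn : 0 < n) {r : ℝ} (hr : 0 < r) (i : Fin n) :
    ∫ x in Metric.ball (0 : Eucl n) r, (1 - x i ^ 2) * gaussDensity n x =
      gaussProfile n r * ((n + 2) * mixedMoment n r / r ^ 3) := by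
  have h := setIntegral_ball_fderiv_single hn
    (g := fun x : Eucl n => x i * gaussDensity n x)
    ((contDiff_coord i).mul contDiff_gaussDensity) i hr
  have hd : ∀ x : Eucl n, fderiv ℝ (fun x : Eucl n => x i * gaussDensity n x) x
      (EuclideanSpace.single i 1) = (1 - x i ^ 2) * gaussDensity n x := by
    intro x
    rw [fderiv_fun_mul (hasFDerivAt_coord i x).differentiableAt
      (contDiff_gaussDensity.differentiable (by simp) x), (hasFDerivAt_coord i x).fderiv]
    simp [fderiv_gaussDensity, EuclideanSpace.inner_single_right]
    ring
  simp only [hd] at h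
  rw [h, sphereIntegral_congr (g := fun x : Eucl n => gaussProfile n r * x i ^ 2) hr.le
    fun x hx => by rw [gaussDensity_of_norm_eq hx]; ring, sphereIntegral_const_mul,
    sphereIntegral_coord_sq hn hr]
  field_simp

/-! ### First and second variation of the functional -/

namespace IsFlowOf

variable {n : ℕ} {X : Eucl n → Eucl n} {Ψ : Eucl n → ℝ → Eucl n}

theorem continuous_inner_div (h : IsFlowOf X Ψ) (r : ℝ) :
    Continuous fun x => inner ℝ (X x) x / r :=
  (h.smooth.continuous.inner continuous_id).div_const r

/-- The density is a positive constant on the sphere and factors out of the first condition. In the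
second it stays inside the divergence, where its gradient matters. -/
theorem preservesGauss_iff (h : IsFlowOf X Ψ) (hn : 0 < n) {r : ℝ} (hr : 0 < r)
    {A : Set (Eucl n)} {N : Eucl n → Eucl n} (hA : IsBallOrComplWithNormal r A N) :
    PreservesGaussToSecondOrder Ψ A ↔
      sphereIntegral r (fun x => inner ℝ (X x) x / r) = 0 ∧
      sphereIntegral r (fun x => divergence (fun y => gaussDensity n y • X y) x *
        (inner ℝ (X x) x / r)) = 0 := by
  obtain ⟨c, σ, hσ, hev⟩ := h.eventually_gaussMeasure_real hA
  have h1 := ((h.hasDerivAt_setIntegral_ball hn hr contDiff_gaussDensity).const_mul σ).const_add c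
    |>.congr_of_eventuallyEq hev
  have h2 := ((h.hasSecondDerivAt_setIntegral_ball hn hr
    contDiff_gaussDensity).const_add_const_mul c σ).congr_of_eventuallyEq hev
  rw [sphereIntegral_congr (g := fun x => gaussProfile n r * (inner ℝ (X x) x / r)) hr.le
    fun x hx => by rw [gaussDensity_of_norm_eq hx], sphereIntegral_const_mul] at h1
  have hp := (gaussProfile_pos n r).ne'
  constructor
  · rintro ⟨g1, g2⟩
    have e1 := h1.unique g1
    have e2 := h2.unique g2
    simp only [mul_eq_zero, hσ, hp, false_or] at e1 e2
    exact ⟨e1, e2⟩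
  · rintro ⟨e1, e2⟩
    rw [e1, mul_zero, mul_zero] at h1
    rw [e2, mul_zero] at h2
    exact ⟨h1, h2⟩

/-- First and second variation of `fourierF` under a variation preserving Gaussian measure to
second order. -/
theorem hasSecondDerivAt_fourierF (h : IsFlowOf X Ψ) (hn : 0 < n) {r : ℝ} (hr : 0 < r)
    {A : Set (Eucl n)} {N : Eucl n → Eucl n} (hA : IsBallOrComplWithNormal r A N)
    (hP : PreservesGaussToSecondOrder Ψ A) :
    HasDerivAt (fun t => fourierF (flowSet Ψ A t)) 0 0 ∧
    HasSecondDerivAt (fun t => fourierF (flowSet Ψ A t))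
      (2 * (gaussProfile n r ^ 2 *
        (∑ i, sphereIntegral r (fun x => x i ^ 2 * (inner ℝ (X x) x / r)) ^ 2 -
        2 * (n + 2) * mixedMoment n r / r ^ 2 *
          sphereIntegral r (fun x => (inner ℝ (X x) x / r) ^ 2)))) 0 := by
  obtain ⟨hf0, hL0⟩ := (h.preservesGauss_iff hn hr hA).1 hP
  have hev := h.eventually_fourierF hA
  set f : Eucl n → ℝ := fun x => inner ℝ (X x) x / r with hf
  have hfc : Continuous f := h.continuous_inner_div r
  set ρ := gaussProfile n r
  set κ := mixedMoment n r
  set a : Fin n → ℝ := fun i => sphereIntegral r fun x => x i ^ 2 * f x with ha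
  set w : Fin n → Eucl n → ℝ := fun i x => (1 - x i ^ 2) * gaussDensity n x with hw
  have hq : ∀ i, ContDiff ℝ (⊤ : ℕ∞) fun x : Eucl n => 1 - x i ^ 2 := fun i =>
    contDiff_const.sub ((contDiff_coord i).pow 2)
  have hws : ∀ i, ContDiff ℝ (⊤ : ℕ∞) (w i) := fun i => (hq i).mul contDiff_gaussDensity
  have hci : ∀ i, Continuous fun x : Eucl n => x i ^ 2 * f x := fun i =>
    ((continuous_coord i).pow 2).mul hfc
  have hf2 : Continuous fun x => f x ^ 2 := hfc.pow 2
  have hasum : ∑ i, a i = 0 := by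
    rw [ha, ← sphereIntegral_sum _ _ fun i _ => hci i, ← mul_zero (r ^ 2), ← hf0,
      ← sphereIntegral_const_mul]
    exact sphereIntegral_congr hr.le fun x hx => by
      simp only [← Finset.sum_mul, ← norm_sq_eq_sum_sq, hx]
  have h0 : ∀ i, ∫ x in flowSet Ψ (Metric.ball 0 r) 0, w i x = ρ * ((n + 2) * κ / r ^ 3) :=
    fun i => by rw [h.setIntegral_flowSet_zero, hw, setIntegral_ball_one_sub_coord_sq hn hr]
  have h1 : ∀ i, HasDerivAt (fun t => ∫ x in flowSet Ψ (Metric.ball 0 r) t, w i x)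
      (-(ρ * a i)) 0 := by
    intro i
    refine (h.hasDerivAt_setIntegral_ball hn hr (hws i)).congr_deriv ?_
    rw [sphereIntegral_congr (g := fun x => ρ * f x + -ρ * (x i ^ 2 * f x)) hr.le fun x hx => by
      simp only [hw, gaussDensity_of_norm_eq hx, hf]; ring,
      sphereIntegral_add r (hfc.const_mul _) ((hci i).const_mul _), sphereIntegral_const_mul,
      sphereIntegral_const_mul, hf0]
    ring
  set L : Eucl n → ℝ := divergence fun y => gaussDensity n y • X y with hLdef
  have hρX : ContDiff ℝ (⊤ : ℕ∞) fun y => gaussDensity n y • X y :=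
    contDiff_gaussDensity.smul h.smooth
  have hLc : Continuous L := (contDiff_divergence hρX).continuous
  -- Splitting off `1 - x_i²` isolates `L = div (γ X)`, the quantity in the second-order measure
  -- condition.
  have hdw : ∀ i x, divergence (fun y => w i y • X y) x =
      (1 - x i ^ 2) * L x - 2 * gaussDensity n x * (X x i * x i) := by
    intro i x
    have e : (fun y => w i y • X y) = fun y => (1 - y i ^ 2) • (gaussDensity n y • X y) := by
      ext1 y; rw [smul_smul]
    rw [e, divergence_smul ((hq i).differentiable (by simp) x)
      (hρX.differentiable (by simp) x), (((hasFDerivAt_coord i x).pow 2).const_sub 1).fderiv]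
    simp
    ring
  set d : Fin n → ℝ := fun i =>
    sphereIntegral r fun x => divergence (fun y => w i y • X y) x * f x with hd
  have h2 : ∀ i, HasSecondDerivAt (fun t => ∫ x in flowSet Ψ (Metric.ball 0 r) t, w i x)
      (d i) 0 := fun i => h.hasSecondDerivAt_setIntegral_ball hn hr (hws i)
  -- Summed over `i`, the coefficient of `L f` is the constant `n - r²` on the sphere, so that term
  -- integrates to zero by `hL0`.
  have hdsum : ∑ i, d i = -(2 * ρ * r) * sphereIntegral r fun x => f x ^ 2 := by
    have hdc : ∀ i, Continuous fun x => divergence (fun y => w i y • X y) x * f x := fun i =>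
      (contDiff_divergence ((hws i).smul h.smooth)).continuous.mul hfc
    have hLf : Continuous fun x => L x * f x := hLc.mul hfc
    rw [hd, ← sphereIntegral_sum _ _ fun i _ => hdc i,
      sphereIntegral_congr (g := fun x => ((n : ℝ) - r ^ 2) * (L x * f x) +
        -(2 * ρ * r) * f x ^ 2) hr.le fun x hx => ?_,
      sphereIntegral_add r (hLf.const_mul _) (hf2.const_mul _), sphereIntegral_const_mul,
      sphereIntegral_const_mul, hL0, mul_zero, zero_add]
    simp only [hdw, ← Finset.sum_mul, Finset.sum_sub_distrib, ← Finset.mul_sum,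
      ← inner_eq_sum_mul, ← norm_sq_eq_sum_sq, hx, gaussDensity_of_norm_eq hx]
    have : inner ℝ (X x) x = r * f x := by simp only [hf]; field_simp
    rw [this]
    simp
    ring
  constructor
  · refine HasDerivAt.congr_of_eventuallyEq ?_ hev
    refine (HasDerivAt.fun_sum fun i _ => (h1 i).fun_pow 2).congr_deriv ?_
    simp only [h0]
    have : ∀ i, ((2 : ℕ) : ℝ) * (ρ * ((n + 2) * κ / r ^ 3)) ^ (2 - 1) * -(ρ * a i) =
        (-2 * (ρ * ((n + 2) * κ / r ^ 3)) * ρ) * a i := by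
      intro i
      norm_num
      ring
    simp only [this, ← Finset.mul_sum, hasum, mul_zero]
  · have := hasSecondDerivAt_sum_sq Finset.univ h1 h2
    convert this.congr_of_eventuallyEq hev using 1
    change 2 * (ρ ^ 2 * (∑ i, a i ^ 2 - 2 * (n + 2) * κ / r ^ 2 *
      sphereIntegral r fun x => f x ^ 2)) = _
    simp only [h0, ← Finset.mul_sum, Finset.sum_add_distrib, hdsum, neg_sq, mul_pow]
    field_simp
    ring

theorem sphereIntegral_inner_normal_sq {r : ℝ} (hr : 0 < r) {A : Set (Eucl n)}
    {N : Eucl n → Eucl n} (hA : IsBallOrComplWithNormal r A N) (X : Eucl n → Eucl n) :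
    sphereIntegral r (fun x => inner ℝ (X x) (N x) ^ 2) =
      sphereIntegral r (fun x => (inner ℝ (X x) x / r) ^ 2) := by
  refine sphereIntegral_congr hr.le fun x hx => ?_
  rcases hA with ⟨-, rfl⟩ | ⟨-, rfl⟩ <;>
  · simp only [inner_neg_right, real_inner_smul_right, hx]
    ring

theorem exists_inner_normal_eq {r : ℝ} {A : Set (Eucl n)}
    {N : Eucl n → Eucl n} (hA : IsBallOrComplWithNormal r A N) (X : Eucl n → Eucl n) :
    ∃ σ : ℝ, σ ≠ 0 ∧ ∀ x, ‖x‖ = r → inner ℝ (X x) x / r = σ * inner ℝ (X x) (N x) := by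
  rcases hA with ⟨-, rfl⟩ | ⟨-, rfl⟩
  · refine ⟨1, one_ne_zero, fun x hx => ?_⟩
    simp only [real_inner_smul_right, hx]
    ring
  · refine ⟨-1, by norm_num, fun x hx => ?_⟩
    simp only [inner_neg_right, real_inner_smul_right, hx]
    ring

/-- The second variation is at most twice `variationConst` times the squared `L²` norm. -/
theorem half_secondVariation_le (h : IsFlowOf X Ψ) (hn : 0 < n) {r : ℝ} (hr : 0 < r)
    (hf0 : sphereIntegral r (fun x => inner ℝ (X x) x / r) = 0) :
    gaussProfile n r ^ 2 *
        (∑ i, sphereIntegral r (fun x => x i ^ 2 * (inner ℝ (X x) x / r)) ^ 2 -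
        2 * (n + 2) * mixedMoment n r / r ^ 2 *
          sphereIntegral r (fun x => (inner ℝ (X x) x / r) ^ 2)) ≤
      variationConst n r * sphereIntegral r (fun x => (inner ℝ (X x) x / r) ^ 2) := by
  have := sum_sq_moment_le hn hr (h.continuous_inner_div r) hf0
  set S := ∑ i, sphereIntegral r (fun x => x i ^ 2 * (inner ℝ (X x) x / r)) ^ 2
  set I := sphereIntegral r fun x => (inner ℝ (X x) x / r) ^ 2
  calc _ ≤ gaussProfile n r ^ 2 * (2 * mixedMoment n r * I -
        2 * (n + 2) * mixedMoment n r / r ^ 2 * I) := by gcongr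
    _ = _ := by rw [variationConst_eq hn hr]; field_simp; ring

theorem half_secondVariation_eq (h : IsFlowOf X Ψ) (hn : 0 < n) {r : ℝ} (hr : 0 < r)
    (hf0 : sphereIntegral r (fun x => inner ℝ (X x) x / r) = 0) (k : Fin n) {c : ℝ}
    (hk : ∀ x, ‖x‖ = r → inner ℝ (X x) x / r = c * zonalForm k x) :
    gaussProfile n r ^ 2 *
        (∑ i, sphereIntegral r (fun x => x i ^ 2 * (inner ℝ (X x) x / r)) ^ 2 -
        2 * (n + 2) * mixedMoment n r / r ^ 2 *
          sphereIntegral r (fun x => (inner ℝ (X x) x / r) ^ 2)) =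
      variationConst n r * sphereIntegral r (fun x => (inner ℝ (X x) x / r) ^ 2) := by
  rw [sum_sq_moment_eq hn hr (h.continuous_inner_div r) hf0 k hk, variationConst_eq hn hr]
  field_simp
  ring

/-- All variations of a ball or its complement that preserve Gaussian measure to second order. -/
theorem secondVariation_bounds (h : IsFlowOf X Ψ) (hn : 0 < n) {r : ℝ} (hr : 0 < r)
    {A : Set (Eucl n)} {N : Eucl n → Eucl n} (hA : IsBallOrComplWithNormal r A N)
    (hP : PreservesGaussToSecondOrder Ψ A) :
    HasDerivAt (fun t => fourierF (flowSet Ψ A t)) 0 0 ∧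
    ∃ F₂ : ℝ, HasSecondDerivAt (fun t => fourierF (flowSet Ψ A t)) F₂ 0 ∧
      (1 / 2) * F₂ ≤ variationConst n r * sphereIntegral r (fun x => inner ℝ (X x) (N x) ^ 2) ∧
      (∀ k : Fin n,
        (∃ c : ℝ, ∀ x ∈ Metric.sphere (0 : Eucl n) r,
          inner ℝ (X x) (N x) = c * zonalForm k x) →
        (1 / 2) * F₂ =
          variationConst n r * sphereIntegral r (fun x => inner ℝ (X x) (N x) ^ 2)) ∧
      (r ^ 2 ≤ (n : ℝ) + 2 → F₂ ≤ 0) ∧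
      (r ^ 2 < (n : ℝ) + 2 →
        (∃ x ∈ Metric.sphere (0 : Eucl n) r, inner ℝ (X x) (N x) ≠ 0) → F₂ < 0) := by
  obtain ⟨hf0, -⟩ := (h.preservesGauss_iff hn hr hA).1 hP
  obtain ⟨hF1, hF2⟩ := h.hasSecondDerivAt_fourierF hn hr hA hP
  have hle := h.half_secondVariation_le hn hr hf0
  obtain ⟨σ, hσ, hN⟩ := exists_inner_normal_eq hA X
  have hf2 : Continuous fun x => (inner ℝ (X x) x / r) ^ 2 := (h.continuous_inner_div r).pow 2
  have hκ := mixedMoment_pos hn hr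
  have hρ := gaussProfile_pos n r
  refine ⟨hF1, _, hF2, ?_, ?_, ?_, ?_⟩
  · rw [sphereIntegral_inner_normal_sq hr hA]
    linarith
  · rintro k ⟨c, hc⟩
    have := h.half_secondVariation_eq hn hr hf0 k (c := σ * c) fun x hx => by
      rw [hN x hx, hc x (by simpa using hx), mul_assoc]
    rw [sphereIntegral_inner_normal_sq hr hA]
    linarith
  · intro hrn
    have h1 := sphereIntegral_nonneg hr.le fun x => sq_nonneg (inner ℝ (X x) x / r)
    have h2 : variationConst n r ≤ 0 := by
      rw [variationConst_eq hn hr]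
      exact mul_nonpos_of_nonneg_of_nonpos (by positivity) (by linarith)
    linarith [mul_nonpos_of_nonpos_of_nonneg h2 h1]
  · rintro hrn ⟨x, hx, hne⟩
    replace hx : ‖x‖ = r := by simpa using hx
    have h1 := sphereIntegral_pos hr hf2 (fun x => sq_nonneg _) hx (by
      rw [hN x hx]
      exact pow_ne_zero 2 (mul_ne_zero hσ hne))
    have h2 : variationConst n r < 0 := by
      rw [variationConst_eq hn hr]
      exact mul_neg_of_pos_of_neg (by positivity) (by linarith)
    linarith [mul_neg_of_neg_of_pos h2 h1]

end IsFlowOf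

/-! ### Existence and symmetry of flows -/

/-- A smooth compactly supported vector field has a flow. -/
theorem exists_isFlowOf_of_hasCompactSupport {n : ℕ} {X : Eucl n → Eucl n}
    (hX : ContDiff ℝ (⊤ : ℕ∞) X) (hc : HasCompactSupport X) : ∃ Ψ, IsFlowOf X Ψ := by
  obtain ⟨K, hK⟩ := hX.lipschitzWith_of_hasCompactSupport hc (by simp)
  obtain ⟨M, hM⟩ := hc.exists_bound_of_continuous hX.continuous
  have hsol : ∀ x : Eucl n, ∃ α : ℝ → Eucl n, α 0 = x ∧
      ∀ t ∈ Icc (-1 : ℝ) 1, HasDerivWithinAt α (X (α t)) (Icc (-1) 1) t := by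
    intro x
    -- Since the field is globally Lipschitz and bounded by `M`, a ball of radius `M` contains the
    -- motion over unit time, so the whole interval is reached at once.
    have hpl : IsPicardLindelof (fun _ => X) (tmin := -1) (tmax := 1)
        ⟨0, by norm_num, by norm_num⟩ x M.toNNReal 0 M.toNNReal K :=
      { lipschitzOnWith := fun _ _ => hK.lipschitzOnWith
        continuousOn := fun _ _ => continuousOn_const
        norm_le := fun _ _ y _ => (hM y).trans (Real.le_coe_toNNReal M)
        mul_max_le := by simp }
    exact hpl.exists_eq_forall_mem_Icc_hasDerivWithinAt₀
  choose Ψ h0 hd using hsol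
  exact ⟨Ψ, hX, h0, fun x t ht =>
    (hd x t (Ioo_subset_Icc_self ht)).hasDerivAt (Icc_mem_nhds ht.1 ht.2)⟩

/-- For an odd field the negative of an integral curve is again one; uniqueness concludes. -/
theorem IsFlowOf.apply_neg {n : ℕ} {X : Eucl n → Eucl n} {Ψ : Eucl n → ℝ → Eucl n}
    (h : IsFlowOf X Ψ) (hodd : ∀ x, X (-x) = -X x) (x : Eucl n) {t : ℝ}
    (ht : t ∈ Ioo (-1 : ℝ) 1) : Ψ (-x) t = -Ψ x t := by
  refine integralCurve_eqOn_Ioo h.smooth (α := fun t => Ψ (-x) t) (β := fun t => -Ψ x t)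
    (a := -1) (b := 1) (t₀ := 0) (by norm_num) (fun s hs => h.ode _ s hs) (fun s hs => ?_)
    (by simp [h.initial]) ht
  rw [hodd]
  exact (h.ode x s hs).fun_neg

theorem IsFlowOf.neg_mem_flowSet_iff {n : ℕ} {X : Eucl n → Eucl n} {Ψ : Eucl n → ℝ → Eucl n}
    (h : IsFlowOf X Ψ) (hodd : ∀ x, X (-x) = -X x) {A : Set (Eucl n)}
    (hA : ∀ x ∈ A, -x ∈ A) {t : ℝ} (ht : t ∈ Ioo (-1 : ℝ) 1) (x : Eucl n) :
    -x ∈ flowSet Ψ A t ↔ x ∈ flowSet Ψ A t := by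
  have key : ∀ y ∈ flowSet Ψ A t, -y ∈ flowSet Ψ A t := by
    rintro _ ⟨y, hy, rfl⟩
    exact ⟨-y, hA y hy, h.apply_neg hodd y ht⟩
  exact ⟨fun hx => by simpa using key _ hx, key x⟩

/-! ### The explicit variation -/

section ExplicitField

variable {n : ℕ}

/-- The diagonal linear field with `k`-th entry `n - 1` and all other entries `-1`. -/
def zonalField (k : Fin n) (x : Eucl n) : Eucl n :=
  WithLp.toLp 2 fun j => (if j = k then (n : ℝ) - 1 else -1) * x j

/-- The scalar factor equals `r` on the sphere and has gradient `r x`, while the linear field has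
trace zero. Values and divergence can thus be adjusted separately. -/
theorem explicitField_eq (r : ℝ) (k : Fin n) (x : Eucl n) :
    explicitField r k x = (r * (1 + (‖x‖ ^ 2 - r ^ 2) / 2)) • zonalField k x := by
  ext j
  simp only [explicitField, zonalField, PiLp.smul_apply, smul_eq_mul]
  ring

theorem contDiff_zonalField (k : Fin n) : ContDiff ℝ (⊤ : ℕ∞) (zonalField k) :=
  contDiff_euclidean.2 fun i => contDiff_const.mul (contDiff_coord i)

theorem contDiff_explicitField_factor (r : ℝ) :
    ContDiff ℝ (⊤ : ℕ∞) fun x : Eucl n => r * (1 + (‖x‖ ^ 2 - r ^ 2) / 2) :=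
  contDiff_const.mul (contDiff_const.add (((contDiff_norm_sq ℝ).sub contDiff_const).div_const 2))

theorem contDiff_explicitField (r : ℝ) (k : Fin n) : ContDiff ℝ (⊤ : ℕ∞) (explicitField r k) := by
  rw [funext (explicitField_eq r k)]
  exact (contDiff_explicitField_factor r).smul (contDiff_zonalField k)

theorem explicitField_neg (r : ℝ) (k : Fin n) (x : Eucl n) :
    explicitField r k (-x) = -explicitField r k x := by
  ext j
  simp only [explicitField, PiLp.neg_apply, norm_neg]
  ring

theorem inner_zonalField (k : Fin n) (x : Eucl n) : inner ℝ (zonalField k x) x = zonalForm k x := by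
  rw [inner_eq_sum_mul, zonalForm, ← Finset.add_sum_erase _ _ (Finset.mem_univ k), sub_eq_add_neg,
    ← Finset.sum_neg_distrib]
  congr 1
  · simp only [zonalField, if_true]; ring
  · refine Finset.sum_congr rfl fun j hj => ?_
    simp only [zonalField, if_neg (Finset.ne_of_mem_erase hj)]
    ring

theorem divergence_zonalField (k : Fin n) (x : Eucl n) : divergence (zonalField k) x = 0 := by
  have h : ∀ i v, fderiv ℝ (zonalField k) x v i = (if i = k then (n : ℝ) - 1 else -1) * v i := by
    intro i v
    have h1 : HasFDerivAt (fun y => zonalField k y i)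
        ((EuclideanSpace.proj i : Eucl n →L[ℝ] ℝ).comp (fderiv ℝ (zonalField k) x)) x :=
      (EuclideanSpace.proj i : Eucl n →L[ℝ] ℝ).hasFDerivAt.comp x
        ((contDiff_zonalField k).differentiable (by simp) x).hasFDerivAt
    have h2 := (hasFDerivAt_coord i x).const_mul (if i = k then (n : ℝ) - 1 else -1)
    have h3 := congrArg (fun T : Eucl n →L[ℝ] ℝ => T v) (h1.unique h2)
    simp only [ContinuousLinearMap.comp_apply, smul_apply, PiLp.proj_apply,
      smul_eq_mul] at h3
    exact h3
  have h3 : ∀ i : Fin n, (if i = k then (n : ℝ) - 1 else -1) = (if i = k then (n : ℝ) else 0) - 1 := by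
    intro i; split_ifs <;> ring
  simp [divergence, h, h3]

theorem divergence_explicitField (r : ℝ) (k : Fin n) (x : Eucl n) :
    divergence (explicitField r k) x = r * zonalForm k x := by
  have h1 := ((((hasStrictFDerivAt_norm_sq x).hasFDerivAt.sub_const (r ^ 2)).mul_const
    ((2 : ℝ)⁻¹)).const_add 1).const_mul r
  simp only [← div_eq_mul_inv] at h1
  rw [funext (explicitField_eq r k), divergence_smul h1.differentiableAt
    ((contDiff_zonalField k).differentiable (by simp) x), divergence_zonalField, h1.fderiv,
    ← inner_zonalField, real_inner_comm]
  simp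

theorem sphereIntegral_zonalForm (hn : 0 < n) {r : ℝ} (hr : 0 < r) (k : Fin n) :
    sphereIntegral r (zonalForm k) = 0 := by
  have hn' : (n : ℝ) ≠ 0 := by exact_mod_cast hn.ne'
  have hc : Continuous fun x : Eucl n => x k ^ 2 := (continuous_coord k).pow 2
  rw [sphereIntegral_congr (g := fun x : Eucl n => n * x k ^ 2 + -r ^ 2) hr.le fun x hx => by
      rw [zonalForm_eq, hx]; ring,
    sphereIntegral_add r (hc.const_mul _) continuous_const, sphereIntegral_const_mul,
    sphereIntegral_coord_sq_eq hn hr, sphereIntegral_const]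
  obtain ⟨m, rfl⟩ := Nat.exists_eq_succ_of_ne_zero hn.ne'
  simp only [Nat.succ_eq_add_one, Nat.add_sub_cancel] at *
  field_simp
  ring

theorem sphereIntegral_zonalForm_sq_pos (hn : 2 ≤ n) {r : ℝ} (hr : 0 < r) (k : Fin n) :
    0 < sphereIntegral r (fun x => zonalForm k x ^ 2) := by
  have hc : Continuous fun x : Eucl n => zonalForm k x ^ 2 := by
    simp only [zonalForm_eq]
    exact ((((continuous_coord k).pow 2).const_mul _).sub (continuous_norm.pow 2)).pow 2
  have hx : ‖r • EuclideanSpace.single k (1 : ℝ)‖ = r := by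
    simp [norm_smul, abs_of_pos hr]
  refine sphereIntegral_pos hr hc (fun x => sq_nonneg _) hx ?_
  rw [zonalForm_eq, hx]
  have hn' : (2 : ℝ) ≤ n := by exact_mod_cast hn
  have : 0 < ((n : ℝ) - 1) * r ^ 2 := mul_pos (by linarith) (by positivity)
  refine pow_ne_zero 2 (ne_of_gt ?_)
  simp
  linarith

/-- There is a symmetric variation of the ball or its complement with the explicit field. -/
theorem exists_explicit_variation (hn : 2 ≤ n) {r : ℝ} (hr : 0 < r)
    {A : Set (Eucl n)} {N : Eucl n → Eucl n} (hA : IsBallOrComplWithNormal r A N) (k : Fin n) :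
    ∃ (X : Eucl n → Eucl n) (Ψ : Eucl n → ℝ → Eucl n),
      IsFlowOf X Ψ ∧
      (∀ᶠ x in 𝓝ˢ (Metric.sphere (0 : Eucl n) r), X x = explicitField r k x) ∧
      (∀ t ∈ Ioo (-1 : ℝ) 1, ∀ x, -x ∈ flowSet Ψ A t ↔ x ∈ flowSet Ψ A t) ∧
      PreservesGaussToSecondOrder Ψ A ∧
      HasDerivAt (fun t => fourierF (flowSet Ψ A t)) 0 0 ∧
      ∃ F₂ : ℝ, HasSecondDerivAt (fun t => fourierF (flowSet Ψ A t)) F₂ 0 ∧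
        (1 / 2) * F₂ = variationConst n r * sphereIntegral r (fun x => zonalForm k x ^ 2) ∧
        ((n : ℝ) + 2 < r ^ 2 → 0 < F₂) := by
  have hn0 : 0 < n := by omega
  -- The cutoff equals `1` on a ball containing a neighborhood of the sphere, and it is even, so the
  -- field stays odd.
  let b : ContDiffBump (0 : Eucl n) := ⟨r + 1, r + 2, by linarith, by linarith⟩
  set X : Eucl n → Eucl n := fun x => b x • explicitField r k x with hXdef
  have hXs : ContDiff ℝ (⊤ : ℕ∞) X := b.contDiff.smul (contDiff_explicitField r k)
  have hXc : HasCompactSupport X := b.hasCompactSupport.smul_right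
  have hXodd : ∀ x, X (-x) = -X x := fun x => by
    simp only [hXdef, b.neg, explicitField_neg, smul_neg]
  have hXeq : ∀ x : Eucl n, ‖x‖ < r + 1 → X x = explicitField r k x := fun x hx => by
    simp only [hXdef]
    rw [b.one_of_mem_closedBall (by simpa using hx.le), one_smul]
  have hXnear : ∀ x : Eucl n, ‖x‖ = r → X =ᶠ[𝓝 x] explicitField r k := fun x hx => by
    filter_upwards [(isOpen_lt continuous_norm continuous_const).mem_nhds
      (show ‖x‖ < r + 1 by linarith)] with y hy using hXeq y hy
  obtain ⟨Ψ, hΨ⟩ := exists_isFlowOf_of_hasCompactSupport hXs hXc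
  have hinner : ∀ x : Eucl n, ‖x‖ = r → inner ℝ (X x) x = r * zonalForm k x := fun x hx => by
    rw [hXeq x (by linarith), explicitField_eq, real_inner_smul_left, inner_zonalField, hx]
    ring
  have hf : ∀ x : Eucl n, ‖x‖ = r → inner ℝ (X x) x / r = zonalForm k x := fun x hx => by
    rw [hinner x hx, mul_div_cancel_left₀ _ hr.ne']
  -- On the sphere `div (γ X) = γ (div X - ⟨X, x⟩)`, and both terms in the bracket equal `r q_k`;
  -- the correction `g` is chosen for this cancellation.
  have hdiv : ∀ x : Eucl n, ‖x‖ = r →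
      divergence (fun y => gaussDensity n y • X y) x = 0 := fun x hx => by
    have h1 : divergence X x = r * zonalForm k x := by
      rw [← divergence_explicitField, divergence, (hXnear x hx).fderiv_eq, divergence]
    rw [divergence_smul (contDiff_gaussDensity.differentiable (by simp) x)
      (hXs.differentiable (by simp) x), fderiv_gaussDensity, real_inner_comm, hinner x hx, h1]
    ring
  have hP : PreservesGaussToSecondOrder Ψ A := by
    refine (hΨ.preservesGauss_iff hn0 hr hA).2 ⟨?_, ?_⟩
    · rw [sphereIntegral_congr hr.le hf]
      exact sphereIntegral_zonalForm hn0 hr k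
    · rw [sphereIntegral_congr (g := fun _ => 0) hr.le fun x hx => by rw [hdiv x hx, zero_mul],
        sphereIntegral_const, zero_mul]
  obtain ⟨hF1, F₂, hF2, -, heq, -, -⟩ := hΨ.secondVariation_bounds hn0 hr hA hP
  obtain ⟨σ, hσ, hN⟩ := IsFlowOf.exists_inner_normal_eq hA X
  have hval : (1 / 2) * F₂ = variationConst n r * sphereIntegral r (fun x => zonalForm k x ^ 2) := by
    rw [heq k ⟨σ⁻¹, fun x hx => ?_⟩, IsFlowOf.sphereIntegral_inner_normal_sq hr hA,
      sphereIntegral_congr hr.le fun x hx => by rw [hf x hx]]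
    have hx : ‖x‖ = r := by simpa using hx
    rw [← hf x hx, hN x hx, inv_mul_cancel_left₀ hσ]
  refine ⟨X, Ψ, hΨ, ?_, fun t ht x => hΨ.neg_mem_flowSet_iff hXodd ?_ ht x, hP, hF1, F₂, hF2,
    hval, fun hrn => ?_⟩
  · refine eventually_nhdsSet_iff_forall.2 fun x hx => hXnear x (by simpa using hx)
  · rcases hA with ⟨rfl, -⟩ | ⟨rfl, -⟩ <;> simp
  · have h1 := sphereIntegral_zonalForm_sq_pos hn hr k
    have h2 : 0 < variationConst n r := by
      have := mixedMoment_pos hn0 hr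
      have := gaussProfile_pos n r
      rw [variationConst_eq hn0 hr]
      exact mul_pos (by positivity) (by linarith)
    linarith [mul_pos h2 h1]

end ExplicitField

end

theorem theorem1p7 (n : ℕ) (hn : 2 ≤ n) (r : ℝ) (hr : 0 < r)
    (A : Set (Eucl n)) (N : Eucl n → Eucl n) (hA : IsBallOrComplWithNormal r A N) :
    -- every variation preserving Gaussian measure to second order
    (∀ (X : Eucl n → Eucl n) (Ψ : Eucl n → ℝ → Eucl n),
      IsFlowOf X Ψ → PreservesGaussToSecondOrder Ψ A →
        HasDerivAt (fun t => fourierF (flowSet Ψ A t)) 0 0 ∧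
        ∃ F₂ : ℝ, HasSecondDerivAt (fun t => fourierF (flowSet Ψ A t)) F₂ 0 ∧
          (1 / 2) * F₂ ≤ variationConst n r * sphereIntegral r (fun x => inner ℝ (X x) (N x) ^ 2) ∧
          (∀ k : Fin n,
            (∃ c : ℝ, ∀ x ∈ Metric.sphere (0 : Eucl n) r,
              inner ℝ (X x) (N x) = c * zonalForm k x) →
            (1 / 2) * F₂ =
              variationConst n r * sphereIntegral r (fun x => inner ℝ (X x) (N x) ^ 2)) ∧
          (r ^ 2 ≤ (n : ℝ) + 2 → F₂ ≤ 0) ∧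
          (r ^ 2 < (n : ℝ) + 2 →
            (∃ x ∈ Metric.sphere (0 : Eucl n) r, inner ℝ (X x) (N x) ≠ 0) → F₂ < 0)) ∧
    -- explicit symmetric variations attaining the bound
    (∀ k : Fin n, ∃ (X : Eucl n → Eucl n) (Ψ : Eucl n → ℝ → Eucl n),
      IsFlowOf X Ψ ∧
      (∀ᶠ x in 𝓝ˢ (Metric.sphere (0 : Eucl n) r), X x = explicitField r k x) ∧
      (∀ t ∈ Ioo (-1 : ℝ) 1, ∀ x, -x ∈ flowSet Ψ A t ↔ x ∈ flowSet Ψ A t) ∧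
      PreservesGaussToSecondOrder Ψ A ∧
      HasDerivAt (fun t => fourierF (flowSet Ψ A t)) 0 0 ∧
      ∃ F₂ : ℝ, HasSecondDerivAt (fun t => fourierF (flowSet Ψ A t)) F₂ 0 ∧
        (1 / 2) * F₂ = variationConst n r * sphereIntegral r (fun x => zonalForm k x ^ 2) ∧
        ((n : ℝ) + 2 < r ^ 2 → 0 < F₂)) :=
  ⟨fun _ _ h hP => h.secondVariation_bounds (by omega) hr hA hP,
    fun k => exists_explicit_variation hn hr hA k⟩
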